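/- Let $\Omega$ be a compact metric space, $\mathcal M(\Omega)$ the finite signed Borel measures on $\Omega$, $\mathbb P(\Omega)\subset\mathcal M(\Omega)$ the probability measures, and $\widetilde{\mathbb P}(\Omega)=\{\nu\in\mathcal M(\Omega):\nu(\Omega)=1\}$. Let $K:\Omega\times\Omega\to\mathbb R$ be continuous and symmetric, and for $\mu,\nu\in\mathcal M(\Omega)$ put $$I_K(\mu,\nu)=\int_\Omega\int_\Omega K(x,y)\,d\mu(x)\,d\nu(y),\qquad I_K(\mu)=I_K(\mu,\mu),\qquad U_K^\mu(x)=\int_\Omega K(x,y)\,d\mu(y).$$ Let $\mu\in\mathbb P(\Omega)$ be $K$-invariant, i.e. $U_K^\mu(x)=I_K(\mu)$ for all $x\in\Omega$, and have full support, i.e. $\operatorname{supp}\mu=\Omega$. Then the following conditions are equivalent. 1. $K$ is positive definite modulo a constant: there is $C\in\mathbb R$ with $I_{K+C}(\nu)\ge 0$ for all $\nu\in\mathcal M(\Omega)$. 2. $K$ is conditionally positive definite: $I_K(\nu)\ge0$ for all $\nu\in\mathcal M(\Omega)$ with $\nu(\Omega)=0$. 3. $\mu$ is a (directional) local minimizer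 of $I_K$: for every $\nu\in\mathbb P(\Omega)$ there is $\tau_\nu\in(0,1]$ with $I_K((1-t)\mu+t\nu)\ge I_K(\mu)$ for all $t\in[0,\tau_\nu]$. 4. $\mu$ is a global minimizer of $I_K$ over $\mathbb P(\Omega)$. 5. $\mu$ is a global minimizer of $I_K$ over $\widetilde{\mathbb P}(\Omega)$. 6. $I_K$ is convex on $\mathbb P(\Omega)$; equivalently, $I_K$ is convex on $\widetilde{\mathbb P}(\Omega)$. 7. $I_K$ is convex at $\mu$: for every $\nu\in\mathbb P(\Omega)$ there is $t_\nu\in(0,1]$ with $I_K((1-t)\mu+t\nu)\le(1-t)I_K(\mu)+tI_K(\nu)$ for all $t\in[0,t_\nu)$. 8. $I_K(\mu_1,\mu_2)\le\frac12\big(I_K(\mu_1)+I_K(\mu_2)\big)$ for all $\mu_1,\mu_2\in\mathbb P(\Omega)$; equivalently, for all $\mu_1,\mu_2\in\widetilde{\mathbb P}(\Omega)$. 9. $I_K(\mu,\mu_2)\le\frac12\big(I_K(\mu)+I_K(\mu_2)\big)$ for all $\mu_2\in\mathbb P(\Omega)$. 10. There are real numbers $\lambda_j$ and functions $\phi_j:\Omega\to\mathbb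 R$, $1\le j\le\dim L^2(\Omega,\mu)$ (all $j\ge 1$ if the dimension is infinite), such that $\phi_1$ is constant, $\lambda_j\ge0$ for $j\ge2$, and $$K(x,y)=\sum_{j=1}^{\dim L^2(\Omega,\mu)}\lambda_j\phi_j(x)\phi_j(y)\qquad(x,y\in\Omega),$$ where the series converges absolutely at every point and uniformly on $\Omega\times\Omega$; equivalently, there is such an expansion in which moreover the $\phi_j$ form an orthonormal basis of $L^2(\Omega,\mu)$ and satisfy $\int_\Omega K(x,y)\phi_j(y)\,d\mu(y)=\lambda_j\phi_j(x)$ for all $x\in\Omega$ and all $j$. -/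

import Mathlib

open MeasureTheory Filter

namespace CPDEnergy

noncomputable section

variable {Ω : Type*} [MeasurableSpace Ω]

/-- A kernel on `Ω × Ω`: a continuous symmetric real-valued function. -/
structure IsKernel [TopologicalSpace Ω] (K : Ω → Ω → ℝ) : Prop where
  continuous : Continuous (fun p : Ω × Ω => K p.1 p.2)
  symm : ∀ x y, K x y = K y x

/-- The mixed energy `I_K(μ, ν) = ∫ ∫ K(x, y) dμ(x) dν(y)` of two finite signed measures.
(On a compact metric space every finite signed Borel measure is regular.) -/
def mixedEnergy (K : Ω → Ω → ℝ) (μ ν : SignedMeasure Ω) : ℝ :=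
  ∫ᵛ y, (∫ᵛ x, K x y ∂<•μ) ∂<•ν

/-- The energy `I_K(μ) = I_K(μ, μ)`. -/
def energy (K : Ω → Ω → ℝ) (μ : SignedMeasure Ω) : ℝ := mixedEnergy K μ μ

/-- The potential `U_K^μ(x) = ∫ K(x, y) dμ(y)`. -/
def potential (K : Ω → Ω → ℝ) (μ : SignedMeasure Ω) (x : Ω) : ℝ :=
  ∫ᵛ y, K x y ∂<•μ

variable (Ω) in
/-- The probability measures, as a subset of the space of finite signed measures. -/
def probMeasures : Set (SignedMeasure Ω) :=
  {ν | (∀ s, MeasurableSet s → 0 ≤ ν s) ∧ ν Set.univ = 1}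

variable (Ω) in
/-- The signed measures of total mass one. -/
def unitMassMeasures : Set (SignedMeasure Ω) := {ν | ν Set.univ = 1}

/-- `K` is positive definite: `I_K(ν) ≥ 0` for every finite signed measure `ν`. -/
def IsPosDef (K : Ω → Ω → ℝ) : Prop := ∀ ν : SignedMeasure Ω, 0 ≤ energy K ν

/-- `K` is conditionally positive definite: `I_K(ν) ≥ 0` for every finite signed measure `ν` of
total mass zero. -/
def IsCondPosDef (K : Ω → Ω → ℝ) : Prop :=
  ∀ ν : SignedMeasure Ω, ν Set.univ = 0 → 0 ≤ energy K ν

/-- `K` is positive definite modulo an additive constant. -/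
def IsPosDefModConst (K : Ω → Ω → ℝ) : Prop := ∃ C : ℝ, IsPosDef (fun x y => K x y + C)

/-- `μ` is `K`-invariant: its potential is constant on `Ω`, equal to its energy. -/
def IsInvariant (K : Ω → Ω → ℝ) (μ : SignedMeasure Ω) : Prop :=
  ∀ x, potential K μ x = energy K μ

/-- `μ` is a (directional) local minimizer of `I_K` in the set of probability measures. -/
def IsDirLocalMin (K : Ω → Ω → ℝ) (μ : SignedMeasure Ω) : Prop :=
  ∀ ν ∈ probMeasures Ω, ∃ τ : ℝ, 0 < τ ∧ τ ≤ 1 ∧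
    ∀ t : ℝ, 0 ≤ t → t ≤ τ → energy K μ ≤ energy K ((1 - t) • μ + t • ν)

/-- `I_K` is convex at `μ`. -/
def IsConvexAt (K : Ω → Ω → ℝ) (μ : SignedMeasure Ω) : Prop :=
  ∀ ν ∈ probMeasures Ω, ∃ τ : ℝ, 0 < τ ∧ τ ≤ 1 ∧
    ∀ t : ℝ, 0 ≤ t → t < τ →
      energy K ((1 - t) • μ + t • ν) ≤ (1 - t) * energy K μ + t * energy K ν

/-- The arithmetic mean inequality for the mixed energy of `μ₁` and `μ₂`. -/
def ArithMeanIneq (K : Ω → Ω → ℝ) (μ₁ μ₂ : SignedMeasure Ω) : Prop :=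
  mixedEnergy K μ₁ μ₂ ≤ 1 / 2 * (energy K μ₁ + energy K μ₂)

/-- The dimension of `L²(Ω, μ)`, in `ℕ ∪ {∞}`. -/
def dimL2 (μ : Measure Ω) : ℕ∞ := Cardinal.toENat (Module.rank ℝ (Lp ℝ 2 μ))

/-- The indices `j` with `1 ≤ j ≤ dim L²(Ω, μ)` (all `j ≥ 1` if the dimension is infinite). -/
def indexSet (μ : Measure Ω) : Set ℕ := {j | 1 ≤ j ∧ (j : ℕ∞) ≤ dimL2 μ}

open Classical in
/-- `K(x, y) = ∑_{j = 1}^{dim L²(Ω, μ)} lam j * φ j x * φ j y`, where the series converges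
absolutely at every point and its partial sums converge uniformly on `Ω × Ω`. -/
def IsExpansion (μ : Measure Ω) (K : Ω → Ω → ℝ) (lam : ℕ → ℝ) (φ : ℕ → Ω → ℝ) : Prop :=
  (∀ x y, Summable (fun j : indexSet μ => |lam j * φ j x * φ j y|)) ∧
  TendstoUniformly
    (fun (n : ℕ) (p : Ω × Ω) =>
      ∑ j ∈ (Finset.Icc 1 n).filter (fun j => j ∈ indexSet μ), lam j * φ j p.1 * φ j p.2)
    (fun p => K p.1 p.2) atTop

/-- `φ j`, for `1 ≤ j ≤ dim L²(Ω, μ)`, are functions whose classes form an orthonormal basis of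
`L²(Ω, μ)`, and each `φ j` is an eigenfunction, with eigenvalue `lam j`, of the integral operator
`T_{K,μ} ψ(x) = ∫ K(x, y) ψ(y) dμ(y)`. -/
def IsEigenbasis (μ : Measure Ω) (K : Ω → Ω → ℝ) (lam : ℕ → ℝ) (φ : ℕ → Ω → ℝ) : Prop :=
  (∃ b : HilbertBasis (indexSet μ) ℝ (Lp ℝ 2 μ), ∀ j : indexSet μ, (b j : Ω → ℝ) =ᵐ[μ] φ j) ∧
  ∀ j ∈ indexSet μ, ∀ x, ∫ y, K x y * φ j y ∂μ = lam j * φ j x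

/-- `K` has an absolutely and uniformly convergent expansion
`K(x, y) = ∑_{j = 1}^{dim L²(Ω, μ)} lam j * φ j x * φ j y` in which `φ 1` is constant and
`lam j ≥ 0` for `j ≥ 2`. -/
def HasExpansion (μ : Measure Ω) (K : Ω → Ω → ℝ) : Prop :=
  ∃ (lam : ℕ → ℝ) (φ : ℕ → Ω → ℝ), IsExpansion μ K lam φ ∧
    (∃ c : ℝ, ∀ x, φ 1 x = c) ∧ ∀ j ∈ indexSet μ, 2 ≤ j → 0 ≤ lam j

/-- As `HasExpansion`, where moreover the `φ j` form an orthonormal basis of `L²(Ω, μ)` consisting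
of eigenfunctions of `T_{K,μ}` with eigenvalues `lam j` (a Mercer expansion). -/
def HasMercerExpansion (μ : Measure Ω) (K : Ω → Ω → ℝ) : Prop :=
  ∃ (lam : ℕ → ℝ) (φ : ℕ → Ω → ℝ), IsEigenbasis μ K lam φ ∧ IsExpansion μ K lam φ ∧
    (∃ c : ℝ, ∀ x, φ 1 x = c) ∧ ∀ j ∈ indexSet μ, 2 ≤ j → 0 ≤ lam j

end

end CPDEnergy

/-!
The energy is the quadratic form of a symmetric bilinear form on signed measures, and invariance of
`μ` gives `I_K(μ, ν) = I_K(μ) ν(Ω)`. Hence `I_K(ν - μ) = I_K(ν) - I_K(μ)` for `ν` of mass one, and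
along the segment from `μ` to `ν` the energy is a quadratic polynomial whose leading coefficient is
`I_K(ν - μ)`. All variational conditions therefore lie between conditional positive definiteness,
which makes `I_K` nonnegative on every difference of measures of mass one, and the statement that
`μ` minimizes `I_K` among probability measures.

The circle is closed through the expansion. If `μ` is a minimizer, testing with the measures of
density `1 + ε (f - ∫ f dμ)` shows that the kernel `K - I_K(μ)` is of positive type on `L²(μ)`
(`nonneg_integral_of_isMinOn`); it annihilates the constants. Its integral operator is compact and
symmetric, so there is an orthonormal basis of eigenfunctions beginning with `1`
(`exists_hilbertBasis_indexSet`), and Mercer's theorem (`hasSum_mercer`), which uses the full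
support of `μ`, gives the uniformly convergent expansion (`hasMercerExpansion_of_isMinOn`).
Conversely, in any expansion with constant first function the functions with positive coefficient
are automatically continuous, and on measures of mass zero the energy of the partial sums is a sum
of nonnegative multiples of squares (`HasExpansion.isCondPosDef`). Minimality among probability
measures thus implies conditional positive definiteness without approximating signed measures by
measures with densities.
-/

namespace CPDEnergy

/-! ### Energy as a symmetric bilinear form -/

instance isFiniteMeasure_variation {X : Type*} [MeasurableSpace X] (ν : SignedMeasure X) :
    IsFiniteMeasure ν.variation := by
  rw [← SignedMeasure.totalVariation_eq_variation, SignedMeasure.totalVariation]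
  infer_instance

lemma continuous_left {X : Type*} [TopologicalSpace X] {L : X → X → ℝ}
    (hL : Continuous fun p : X × X => L p.1 p.2) (y : X) : Continuous fun x => L x y :=
  hL.comp (by fun_prop : Continuous fun x => (x, y))

lemma continuous_right {X : Type*} [TopologicalSpace X] {L : X → X → ℝ}
    (hL : Continuous fun p : X × X => L p.1 p.2) (x : X) : Continuous fun y => L x y :=
  hL.comp (by fun_prop : Continuous fun y => (x, y))

lemma mixedEnergy_eq_integral_potential {X : Type*} [TopologicalSpace X] [MeasurableSpace X]
    {K : X → X → ℝ} (hK : IsKernel K) (μ ν : SignedMeasure X) :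
    mixedEnergy K μ ν = ∫ᵛ y, potential K μ y ∂<•ν := by
  unfold mixedEnergy potential
  simp only [fun x y => hK.symm x y]

lemma convex_probMeasures {X : Type*} [MeasurableSpace X] : Convex ℝ (probMeasures X) := by
  intro μ hμ ν hν a b ha hb hab
  refine ⟨fun s hs => ?_, ?_⟩
  · have := hμ.1 s hs; have := hν.1 s hs
    simp only [add_apply, smul_apply, smul_eq_mul]
    positivity
  · simp [hμ.2, hν.2, hab]

lemma convex_unitMassMeasures {X : Type*} [MeasurableSpace X] :
    Convex ℝ (unitMassMeasures X) := by
  intro μ hμ ν hν a b ha hb hab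
  have h1 : μ Set.univ = 1 := hμ
  have h2 : ν Set.univ = 1 := hν
  change (a • μ + b • ν) Set.univ = 1
  simp [h1, h2, hab]

lemma probMeasures_subset_unitMassMeasures {X : Type*} [MeasurableSpace X] :
    probMeasures X ⊆ unitMassMeasures X := fun _ h => h.2

lemma toSignedMeasure_mem_probMeasures {X : Type*} [MeasurableSpace X] (μ : Measure X)
    [IsProbabilityMeasure μ] : μ.toSignedMeasure ∈ probMeasures X := by
  refine ⟨fun s hs => ?_, ?_⟩
  · rw [Measure.toSignedMeasure_apply_measurable hs]; positivity
  · simp [Measure.toSignedMeasure_apply_measurable MeasurableSet.univ]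

lemma IsCondPosDef.nonneg_energy_sub {X : Type*} [MeasurableSpace X] {K : X → X → ℝ}
    (h : IsCondPosDef K) {μ ν : SignedMeasure X}
    (hμ : μ ∈ unitMassMeasures X) (hν : ν ∈ unitMassMeasures X) : 0 ≤ energy K (μ - ν) := by
  have h1 : μ Set.univ = 1 := hμ
  have h2 : ν Set.univ = 1 := hν
  exact h _ (by simp [h1, h2])

lemma isConvexAt_of_convexOn {X : Type*} [MeasurableSpace X] {K : X → X → ℝ}
    {μ : SignedMeasure X} (hμ : μ ∈ probMeasures X)
    (h : ConvexOn ℝ (probMeasures X) (energy K)) : IsConvexAt K μ := by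
  refine fun ν hν => ⟨1, one_pos, le_rfl, fun t h0 h1 => ?_⟩
  exact h.2 hμ hν (by linarith) h0 (by ring)

lemma isDirLocalMin_of_isMinOn {X : Type*} [MeasurableSpace X] {K : X → X → ℝ}
    {μ : SignedMeasure X} (hμ : μ ∈ probMeasures X)
    (h : IsMinOn (energy K) (probMeasures X) μ) : IsDirLocalMin K μ :=
  fun _ hν => ⟨1, one_pos, le_rfl, fun _ h0 h1 =>
    isMinOn_iff.1 h _ (convex_probMeasures hμ hν (by linarith) h0 (by ring))⟩

lemma mixedEnergy_of_isInvariant {X : Type*} [TopologicalSpace X] [MeasurableSpace X]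
    {K : X → X → ℝ} (hK : IsKernel K) {μ : SignedMeasure X} (hμ : IsInvariant K μ)
    (ν : SignedMeasure X) : mixedEnergy K μ ν = energy K μ * ν Set.univ := by
  rw [mixedEnergy_eq_integral_potential hK]
  simp [hμ _, mul_comm]

/-- A kernel uniformly bounded by `ε` has energy at most `ε` times the squared total variation. -/
lemma abs_energy_le {X : Type*} [MeasurableSpace X] {L : X → X → ℝ} {ε : ℝ}
    (hε : ∀ x y, |L x y| ≤ ε) (ν : SignedMeasure X) :
    |energy L ν| ≤ ε * ν.variation.real Set.univ ^ 2 := by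
  have hB : ‖(ContinuousLinearMap.lsmul ℝ ℝ : ℝ →L[ℝ] ℝ →L[ℝ] ℝ).flip‖ ≤ 1 := by
    rw [ContinuousLinearMap.opNorm_flip]
    exact ContinuousLinearMap.opNorm_lsmul_le
  have key : ∀ (f : X → ℝ) (c : ℝ), (∀ x, |f x| ≤ c) →
      |∫ᵛ x, f x ∂<•ν| ≤ c * ν.variation.real Set.univ := by
    intro f c hf
    rcases isEmpty_or_nonempty X with h | ⟨⟨x₀⟩⟩
    · simp [VectorMeasure.integral_of_isEmpty, Set.eq_empty_of_isEmpty]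
    have hc : 0 ≤ c := (abs_nonneg _).trans (hf x₀)
    refine (VectorMeasure.norm_integral_le_of_norm_le_const (μ := ν) (f := f)
      (B := (ContinuousLinearMap.lsmul ℝ ℝ : ℝ →L[ℝ] ℝ →L[ℝ] ℝ).flip)
      (Eventually.of_forall hf)).trans ?_
    calc _ ≤ c * 1 * ν.variation.real Set.univ := by gcongr
      _ = _ := by ring
  unfold energy mixedEnergy
  refine (key _ _ fun y => key _ _ fun x => hε x y).trans_eq (by ring)

section Energy

variable {Ω : Type*} [MetricSpace Ω] [CompactSpace Ω] [MeasurableSpace Ω] [BorelSpace Ω]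

lemma integrable_of_continuous {f : Ω → ℝ} (hf : Continuous f) (ν : SignedMeasure Ω) :
    VectorMeasure.Integrable ν f := by
  obtain ⟨C, hC⟩ := isCompact_univ.exists_bound_of_continuousOn hf.continuousOn
  exact Integrable.of_bound hf.aestronglyMeasurable C (Eventually.of_forall fun x => hC x trivial)

/-- A signed integral is the difference of the integrals against the Jordan parts. -/
lemma integral_eq_sub_jordan {f : Ω → ℝ} (hf : Continuous f) (ν : SignedMeasure Ω) :
    ∫ᵛ x, f x ∂<•ν = ∫ x, f x ∂ν.toJordanDecomposition.posPart
      - ∫ x, f x ∂ν.toJordanDecomposition.negPart := by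
  conv_lhs => rw [← ν.toSignedMeasure_toJordanDecomposition, JordanDecomposition.toSignedMeasure]
  rw [VectorMeasure.integral_sub_vectorMeasure (integrable_of_continuous hf _)
    (integrable_of_continuous hf _)]
  simp

lemma continuous_signedIntegral {L : Ω → Ω → ℝ} (hL : Continuous fun p : Ω × Ω => L p.1 p.2)
    (ν : SignedMeasure Ω) : Continuous fun y => ∫ᵛ x, L x y ∂<•ν := by
  obtain ⟨C, hC⟩ := isCompact_univ.exists_bound_of_continuousOn hL.continuousOn
  refine VectorMeasure.continuous_of_dominated (bound := fun _ => C) (fun y => ?_)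
    (fun y => Eventually.of_forall fun x => hC (x, y) trivial) (integrable_const _)
    (Eventually.of_forall fun x => hL.comp (by fun_prop : Continuous fun y => (x, y)))
  exact (hL.comp (by fun_prop : Continuous fun x => (x, y))).aestronglyMeasurable

lemma integral_swap {L : Ω → Ω → ℝ} (hL : Continuous fun p : Ω × Ω => L p.1 p.2)
    (μ ν : Measure Ω) [IsFiniteMeasure μ] [IsFiniteMeasure ν] :
    ∫ y, ∫ x, L x y ∂μ ∂ν = ∫ x, ∫ y, L x y ∂ν ∂μ := by
  obtain ⟨C, hC⟩ := isCompact_univ.exists_bound_of_continuousOn hL.continuousOn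
  refine integral_integral_swap (f := fun y x => L x y) ?_
  exact Integrable.of_bound (hL.comp continuous_swap).aestronglyMeasurable C
    (Eventually.of_forall fun p => hC p.swap trivial)

lemma continuous_integral {L : Ω → Ω → ℝ} (hL : Continuous fun p : Ω × Ω => L p.1 p.2)
    (ν : Measure Ω) [IsFiniteMeasure ν] : Continuous fun y => ∫ x, L x y ∂ν := by
  simpa using continuous_signedIntegral hL ν.toSignedMeasure

lemma integrable_measure_of_continuous {f : Ω → ℝ} (hf : Continuous f) (ν : Measure Ω)
    [IsFiniteMeasure ν] : Integrable f ν :=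
  hf.integrable_of_hasCompactSupport (HasCompactSupport.of_compactSpace f)

lemma signedIntegral_swap {L : Ω → Ω → ℝ} (hL : Continuous fun p : Ω × Ω => L p.1 p.2)
    (μ ν : SignedMeasure Ω) :
    ∫ᵛ y, (∫ᵛ x, L x y ∂<•μ) ∂<•ν = ∫ᵛ x, (∫ᵛ y, L x y ∂<•ν) ∂<•μ := by
  have hL' : Continuous fun p : Ω × Ω => L p.2 p.1 := hL.comp continuous_swap
  rw [integral_eq_sub_jordan (continuous_signedIntegral hL μ),
    integral_eq_sub_jordan (continuous_signedIntegral hL' ν)]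
  simp only [fun y => integral_eq_sub_jordan (continuous_left hL y) μ,
    fun x => integral_eq_sub_jordan (continuous_right hL x) ν]
  rw [integral_sub, integral_sub, integral_sub, integral_sub, integral_swap hL, integral_swap hL,
    integral_swap hL, integral_swap hL]
  · ring
  all_goals
    refine integrable_measure_of_continuous ?_ _
    first
      | exact continuous_integral hL _
      | exact continuous_integral hL' _

/-- The mixed energy of a continuous kernel, as a bilinear form on signed measures. -/
noncomputable def energyForm (L : Ω → Ω → ℝ) (hL : Continuous fun p : Ω × Ω => L p.1 p.2) :
    LinearMap.BilinForm ℝ (SignedMeasure Ω) :=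
  LinearMap.mk₂ ℝ (mixedEnergy L)
    (fun μ₁ μ₂ ν => by
      unfold mixedEnergy
      rw [← VectorMeasure.integral_fun_add
        (integrable_of_continuous (continuous_signedIntegral hL _) _)
        (integrable_of_continuous (continuous_signedIntegral hL _) _)]
      congr 1 with y
      exact VectorMeasure.integral_add_vectorMeasure
        (integrable_of_continuous (continuous_left hL y) _)
        (integrable_of_continuous (continuous_left hL y) _))
    (fun c μ ν => by
      unfold mixedEnergy
      simp only [VectorMeasure.integral_smul_vectorMeasure]
      exact VectorMeasure.integral_fun_smul ν _ c _)
    (fun μ ν₁ ν₂ => VectorMeasure.integral_add_vectorMeasure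
      (integrable_of_continuous (continuous_signedIntegral hL _) _)
      (integrable_of_continuous (continuous_signedIntegral hL _) _))
    (fun c μ ν => VectorMeasure.integral_smul_vectorMeasure _ _)

variable {K : Ω → Ω → ℝ}

lemma mixedEnergy_comm (hK : IsKernel K) (μ ν : SignedMeasure Ω) :
    mixedEnergy K μ ν = mixedEnergy K ν μ := by
  unfold mixedEnergy
  rw [signedIntegral_swap hK.continuous]
  simp only [hK.symm]

lemma energy_add_const (hK : IsKernel K) (C : ℝ) (ν : SignedMeasure Ω) :
    energy (fun x y => K x y + C) ν = energy K ν + C * ν Set.univ ^ 2 := by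
  unfold energy mixedEnergy
  have h : ∀ y, ∫ᵛ x, (K x y + C) ∂<•ν = (∫ᵛ x, K x y ∂<•ν) + C * ν Set.univ := fun y => by
    rw [VectorMeasure.integral_fun_add (integrable_of_continuous (continuous_left hK.continuous y) _)
      (integrable_of_continuous continuous_const _)]
    simp [mul_comm C]
  simp only [h]
  rw [VectorMeasure.integral_fun_add
    (integrable_of_continuous (continuous_signedIntegral hK.continuous _) _)
    (integrable_of_continuous continuous_const _)]
  simp [pow_two]
  ring


/-- The square expanded, with `I_K(μ, ν) = I_K(μ) ν(Ω)` from invariance. -/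
lemma energy_sub_of_isInvariant (hK : IsKernel K) {μ : SignedMeasure Ω} (hμ : IsInvariant K μ)
    (ν : SignedMeasure Ω) :
    energy K ν = energy K (ν - ν Set.univ • μ) + energy K μ * ν Set.univ ^ 2 := by
  set m := ν Set.univ with hm
  have h1 : mixedEnergy K μ ν = energy K μ * m := mixedEnergy_of_isInvariant hK hμ ν
  have h2 : mixedEnergy K ν μ = energy K μ * m := by rw [mixedEnergy_comm hK, h1]
  let B := energyForm K hK.continuous
  have h1' : B μ ν = energy K μ * m := h1
  have h2' : B ν μ = energy K μ * m := h2
  have h3 : B μ μ = energy K μ := rfl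
  have : B (ν - m • μ) (ν - m • μ) = B ν ν - energy K μ * m ^ 2 := by
    simp only [map_sub, map_smul, LinearMap.sub_apply, LinearMap.smul_apply, smul_eq_mul, h1', h2',
      h3]
    ring
  change B ν ν = B (ν - m • μ) (ν - m • μ) + _
  rw [this]; ring

/-- The energy of a convex combination, in terms of the energy of the difference. -/
lemma energy_combo (hK : IsKernel K) (μ ν : SignedMeasure Ω) (a b : ℝ) (hab : a + b = 1) :
    energy K (a • μ + b • ν) = a * energy K μ + b * energy K ν - a * b * energy K (μ - ν) := by
  let B := energyForm K hK.continuous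
  have hc : B ν μ = B μ ν := mixedEnergy_comm hK ν μ
  change B (a • μ + b • ν) (a • μ + b • ν) = a * B μ μ + b * B ν ν - a * b * B (μ - ν) (μ - ν)
  simp only [map_add, map_sub, map_smul, LinearMap.sub_apply, LinearMap.add_apply,
    LinearMap.smul_apply, smul_eq_mul, hc]
  obtain rfl : b = 1 - a := by linarith
  ring

lemma energy_sub (hK : IsKernel K) (μ ν : SignedMeasure Ω) :
    energy K (μ - ν) = energy K μ + energy K ν - 2 * mixedEnergy K μ ν := by
  let B := energyForm K hK.continuous
  have hc : B ν μ = B μ ν := mixedEnergy_comm hK ν μ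
  change B (μ - ν) (μ - ν) = B μ μ + B ν ν - 2 * B μ ν
  simp only [map_sub, LinearMap.sub_apply, hc]
  ring

lemma arithMeanIneq_iff (hK : IsKernel K) (μ ν : SignedMeasure Ω) :
    ArithMeanIneq K μ ν ↔ 0 ≤ energy K (μ - ν) := by
  rw [energy_sub hK, ArithMeanIneq]
  constructor <;> intro h <;> linarith

/-- Invariance makes the excess energy over `μ` the energy of the difference. -/
lemma energy_sub_invariant (hK : IsKernel K) {μ : SignedMeasure Ω} (hμ : IsInvariant K μ)
    {ν : SignedMeasure Ω} (hν : ν Set.univ = 1) :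
    energy K (μ - ν) = energy K ν - energy K μ := by
  rw [energy_sub hK, mixedEnergy_of_isInvariant hK hμ, hν]
  ring

/-- The constant can be taken to be `-I_K(μ)`: splitting `ν` into `ν(Ω) μ` and a part of mass zero,
the cross terms vanish by invariance. -/
lemma IsCondPosDef.isPosDefModConst (hK : IsKernel K) {μ : SignedMeasure Ω} (hμ : IsInvariant K μ)
    (hμ1 : μ Set.univ = 1) (h : IsCondPosDef K) : IsPosDefModConst K := by
  refine ⟨-energy K μ, fun ν => ?_⟩
  rw [energy_add_const hK, energy_sub_of_isInvariant hK hμ ν]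
  have := h (ν - ν Set.univ • μ) (by simp [hμ1])
  linarith

lemma IsPosDefModConst.isCondPosDef (hK : IsKernel K) (h : IsPosDefModConst K) :
    IsCondPosDef K := by
  obtain ⟨C, hC⟩ := h
  intro ν hν
  have := hC ν
  rwa [energy_add_const hK, hν, zero_pow two_ne_zero, mul_zero, add_zero] at this

lemma IsCondPosDef.convexOn (hK : IsKernel K) (h : IsCondPosDef K) :
    ConvexOn ℝ (unitMassMeasures Ω) (energy K) := by
  refine ⟨convex_unitMassMeasures, fun μ hμ ν hν a b ha hb hab => ?_⟩
  have := h.nonneg_energy_sub hμ hν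
  have : 0 ≤ a * b * energy K (μ - ν) := by positivity
  rw [energy_combo hK μ ν a b hab, smul_eq_mul, smul_eq_mul]
  linarith

lemma IsCondPosDef.isMinOn (hK : IsKernel K) {μ : SignedMeasure Ω} (hμ : IsInvariant K μ)
    (hμ1 : μ Set.univ = 1) (h : IsCondPosDef K) : IsMinOn (energy K) (unitMassMeasures Ω) μ := by
  refine isMinOn_iff.2 fun ν hν => ?_
  have := h.nonneg_energy_sub (ν := ν) hμ1 hν
  rw [energy_sub_invariant hK hμ hν] at this
  linarith

/-- Along the segment from `μ` to `ν` the energy is `I(μ) + t² (I(ν) - I(μ))`. -/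
lemma IsDirLocalMin.isMinOn (hK : IsKernel K) {μ : SignedMeasure Ω} (hμ : IsInvariant K μ)
    (h : IsDirLocalMin K μ) : IsMinOn (energy K) (probMeasures Ω) μ := by
  refine isMinOn_iff.2 fun ν hν => ?_
  obtain ⟨τ, h0, -, hτ⟩ := h ν hν
  have := hτ τ h0.le le_rfl
  rw [energy_combo hK _ _ _ _ (by ring), energy_sub_invariant hK hμ hν.2] at this
  have h2 : 0 ≤ τ ^ 2 * (energy K ν - energy K μ) := by nlinarith
  have := (mul_nonneg_iff_of_pos_left (by positivity)).1 h2
  linarith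

lemma IsConvexAt.isMinOn (hK : IsKernel K) {μ : SignedMeasure Ω} (hμ : IsInvariant K μ)
    (h : IsConvexAt K μ) : IsMinOn (energy K) (probMeasures Ω) μ := by
  refine isMinOn_iff.2 fun ν hν => ?_
  obtain ⟨τ, h0, h1, hτ⟩ := h ν hν
  have := hτ (τ / 2) (by linarith) (by linarith)
  rw [energy_combo hK _ _ _ _ (by ring), energy_sub_invariant hK hμ hν.2] at this
  have h2 : 0 ≤ ((1 - τ / 2) * (τ / 2)) * (energy K ν - energy K μ) := by linarith
  have := (mul_nonneg_iff_of_pos_left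
    (mul_pos (by linarith : 0 < 1 - τ / 2) (by linarith : 0 < τ / 2))).1 h2
  linarith

lemma isMinOn_of_arithMeanIneq (hK : IsKernel K) {μ : SignedMeasure Ω} (hμ : IsInvariant K μ)
    (h : ∀ ν ∈ probMeasures Ω, ArithMeanIneq K μ ν) :
    IsMinOn (energy K) (probMeasures Ω) μ := by
  refine isMinOn_iff.2 fun ν hν => ?_
  have := (arithMeanIneq_iff hK _ _).1 (h ν hν)
  rw [energy_sub_invariant hK hμ hν.2] at this
  linarith

end Energy
/-! ### From an expansion to conditional positive definiteness -/

section Expansion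

variable {Ω : Type*} [MetricSpace Ω] [CompactSpace Ω] [MeasurableSpace Ω] [BorelSpace Ω]
  {K : Ω → Ω → ℝ}

/-- In an expansion whose first function is constant, the functions with positive coefficient are
continuous, since `lam j * (φ j x - φ j y) ^ 2 ≤ K x x - 2 * K x y + K y y`. -/
lemma IsExpansion.continuous {X : Type*} [TopologicalSpace X] [MeasurableSpace X] {μ : Measure X}
    {K : X → X → ℝ} (hK : IsKernel K) {lam : ℕ → ℝ} {φ : ℕ → X → ℝ} (h : IsExpansion μ K lam φ)
    {c : ℝ} (hc : ∀ x, φ 1 x = c) (hlam : ∀ j ∈ indexSet μ, 2 ≤ j → 0 ≤ lam j)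
    {j : ℕ} (hj : j ∈ indexSet μ) (hj2 : 2 ≤ j) (hpos : 0 < lam j) : Continuous (φ j) := by
  classical
  have hbound : ∀ x y, lam j * (φ j x - φ j y) ^ 2 ≤ K x x - 2 * K x y + K y y := by
    intro x y
    have ht := ((h.2.tendsto_at (x, x)).sub ((h.2.tendsto_at (x, y)).const_mul 2)).add
      (h.2.tendsto_at (y, y))
    refine ge_of_tendsto ht ((eventually_ge_atTop j).mono fun n hn => ?_)
    simp only
    rw [Finset.mul_sum, ← Finset.sum_sub_distrib, ← Finset.sum_add_distrib]
    have hmem : j ∈ (Finset.Icc 1 n).filter (fun j => j ∈ indexSet μ) := by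
      simp [hj, hn]; lia
    have := Finset.single_le_sum (f := fun i => lam i * (φ i x - φ i y) ^ 2)
      (s := (Finset.Icc 1 n).filter (fun j => j ∈ indexSet μ)) (fun i hi => ?_) hmem
    · refine this.trans_eq (Finset.sum_congr ?_ fun i _ => by ring)
      ext; simp
    · simp only [Finset.mem_filter, Finset.mem_Icc] at hi
      rcases hi.1.1.eq_or_lt with rfl | h2
      · simp [hc]
      · exact mul_nonneg (hlam i hi.2 h2) (sq_nonneg _)
  refine continuous_iff_continuousAt.2 fun x => ?_
  have hd : Continuous fun y => K x x - 2 * K x y + K y y := by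
    have h1 := hK.continuous.comp (by fun_prop : Continuous fun y : X => (x, y))
    have h2 := hK.continuous.comp (by fun_prop : Continuous fun y : X => (y, y))
    exact (continuous_const.sub (continuous_const.mul h1)).add h2
  have h0 : Tendsto (fun y => (φ j x - φ j y) ^ 2) (nhds x) (nhds 0) := by
    have hd0 : Tendsto (fun y => (K x x - 2 * K x y + K y y) / lam j) (nhds x) (nhds 0) := by
      have := (hd.tendsto x).div_const (lam j)
      rwa [show (K x x - 2 * K x x + K x x) / lam j = 0 by ring] at this
    refine squeeze_zero (fun _ => sq_nonneg _) (fun y => ?_) hd0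
    rw [le_div_iff₀ hpos, mul_comm]
    exact hbound x y
  have h1 : Tendsto (fun y => |φ j x - φ j y|) (nhds x) (nhds 0) := by
    simpa [Real.sqrt_sq_eq_abs] using h0.sqrt
  refine tendsto_iff_dist_tendsto_zero.2 ?_
  simpa [Real.dist_eq, abs_sub_comm] using h1

/-- The energy of a finite sum of products. -/
lemma energy_sum_mul {ι : Type*} (s : Finset ι) {a : ι → ℝ} {ψ : ι → Ω → ℝ}
    (hψ : ∀ i ∈ s, Continuous fun x => a i * ψ i x) (ν : SignedMeasure Ω) :
    energy (fun x y => ∑ i ∈ s, a i * ψ i x * ψ i y) ν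
      = ∑ i ∈ s, a i * (∫ᵛ x, ψ i x ∂<•ν) ^ 2 := by
  unfold energy mixedEnergy
  have hmul : ∀ i, ∀ c : ℝ, ∫ᵛ x, c * ψ i x ∂<•ν = c * ∫ᵛ x, ψ i x ∂<•ν := fun i c =>
    VectorMeasure.integral_fun_smul ν _ c _
  have h1 : ∀ y, ∫ᵛ x, (∑ i ∈ s, a i * ψ i x * ψ i y) ∂<•ν
      = ∑ i ∈ s, (∫ᵛ x, ψ i x ∂<•ν) * (a i * ψ i y) := fun y => by
    rw [VectorMeasure.integral_finsetSum]
    · refine Finset.sum_congr rfl fun i hi => ?_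
      simp only [mul_right_comm (a i) _ (ψ i y)]
      rw [hmul]
      ring
    · exact fun i hi => integrable_of_continuous ((hψ i hi).mul continuous_const) _
  simp only [h1]
  rw [VectorMeasure.integral_finsetSum]
  · refine Finset.sum_congr rfl fun i hi => ?_
    simp only [← mul_assoc]
    rw [hmul]
    ring
  · exact fun i hi => integrable_of_continuous (continuous_const.mul (hψ i hi)) _

lemma energy_sub_kernel {L M : Ω → Ω → ℝ} (hL : Continuous fun p : Ω × Ω => L p.1 p.2)
    (hM : Continuous fun p : Ω × Ω => M p.1 p.2) (ν : SignedMeasure Ω) :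
    energy (fun x y => L x y - M x y) ν = energy L ν - energy M ν := by
  unfold energy mixedEnergy
  rw [← VectorMeasure.integral_fun_sub
    (integrable_of_continuous (continuous_signedIntegral hL _) _)
    (integrable_of_continuous (continuous_signedIntegral hM _) _)]
  congr 1 with y
  exact VectorMeasure.integral_fun_sub (integrable_of_continuous (continuous_left hL y) _)
    (integrable_of_continuous (continuous_left hM y) _)

/-- On signed measures of mass zero the constant first function does not contribute, and each of
the other terms of the expansion contributes a multiple of a square. -/
lemma HasExpansion.isCondPosDef (hK : IsKernel K) {μ : Measure Ω} (h : HasExpansion μ K) :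
    IsCondPosDef K := by
  classical
  obtain ⟨lam, φ, hexp, ⟨c, hc⟩, hlam⟩ := h
  intro ν hν
  have hcont : ∀ j ∈ indexSet μ, Continuous fun x => lam j * φ j x := by
    intro j hj
    rcases (show 1 ≤ j from hj.1).eq_or_lt with rfl | h2
    · simp only [hc]; fun_prop
    · rcases (hlam j hj h2).eq_or_lt with h0 | hpos
      · simp only [← h0, zero_mul]; fun_prop
      · exact continuous_const.mul (hexp.continuous hK hc hlam hj h2 hpos)
  have hcont2 : ∀ j ∈ indexSet μ, Continuous fun p : Ω × Ω => lam j * φ j p.1 * φ j p.2 := by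
    intro j hj
    rcases eq_or_ne (lam j) 0 with h0 | h0
    · simp only [h0, zero_mul]; fun_prop
    · have : Continuous (φ j) := by
        have h1 := (hcont j hj).const_mul (lam j)⁻¹
        simpa only [← mul_assoc, inv_mul_cancel₀ h0, one_mul] using h1
      fun_prop
  set V := ν.variation.real Set.univ with hV
  have hle : ∀ ε > 0, -(ε * V ^ 2) ≤ energy K ν := by
    intro ε hε
    obtain ⟨n, hn⟩ := (Metric.tendstoUniformly_iff.1 hexp.2 ε hε).exists
    set s := (Finset.Icc 1 n).filter (fun j => j ∈ indexSet μ)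
    have hS : Continuous fun p : Ω × Ω => ∑ j ∈ s, lam j * φ j p.1 * φ j p.2 :=
      continuous_finsetSum _ fun j hj => hcont2 j (Finset.mem_filter.1 hj).2
    have h1 := abs_energy_le (L := fun x y => K x y - ∑ j ∈ s, lam j * φ j x * φ j y) (ε := ε)
      (fun x y => (hn (x, y)).le) ν
    rw [energy_sub_kernel hK.continuous hS] at h1
    have h2 : 0 ≤ energy (fun x y => ∑ j ∈ s, lam j * φ j x * φ j y) ν := by
      rw [energy_sum_mul _ fun j hj => hcont j (Finset.mem_filter.1 hj).2]
      refine Finset.sum_nonneg fun j hj => ?_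
      simp only [Finset.mem_filter, Finset.mem_Icc] at hj
      rcases hj.1.1.eq_or_lt with rfl | h2
      · simp [hc, hν]
      · exact mul_nonneg (hlam j hj.2 h2) (sq_nonneg _)
    linarith [(abs_le.1 h1).1]
  by_contra! hneg
  have hpos : 0 < V ^ 2 + 1 := by positivity
  have := hle (-energy K ν / (2 * (V ^ 2 + 1))) (by apply div_pos <;> linarith)
  have h3 : -energy K ν / (2 * (V ^ 2 + 1)) * V ^ 2 ≤ -energy K ν / 2 := by
    rw [div_mul_eq_mul_div, div_le_div_iff₀ (by positivity) two_pos]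
    nlinarith
  linarith

end Expansion

/-! ### From minimality to positive type on `L²` -/

section Density

variable {Ω : Type*} [MetricSpace Ω] [CompactSpace Ω] [MeasurableSpace Ω] [BorelSpace Ω]
  {K : Ω → Ω → ℝ}

/-- If an invariant probability measure `μ` minimizes the energy among probability measures, then
the kernel `K - I_K(μ)` is of positive type on `L²(μ)`, tested on continuous functions: for
continuous `f` of mean `m` and small `ε > 0`, the measure with density `1 + ε (f - m)` is a
competitor. -/
lemma nonneg_integral_of_isMinOn (hK : IsKernel K) {μ : Measure Ω} [IsProbabilityMeasure μ]
    (hinv : IsInvariant K μ.toSignedMeasure)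
    (h : IsMinOn (energy K) (probMeasures Ω) μ.toSignedMeasure) {f : Ω → ℝ} (hf : Continuous f) :
    0 ≤ ∫ y, (∫ x, (K x y - energy K μ.toSignedMeasure) * f x ∂μ) * f y ∂μ := by
  set e := energy K μ.toSignedMeasure with he
  set m := ∫ x, f x ∂μ with hm
  have hfi : Integrable f μ := integrable_measure_of_continuous hf μ
  have hKf : ∀ y, Integrable (fun x => K x y * f x) μ := fun y =>
    integrable_measure_of_continuous ((continuous_left hK.continuous y).mul hf) μ
  have hKi : ∀ y, ∫ x, K x y ∂μ = e := fun y => by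
    have := hinv y
    rw [potential, VectorMeasure.integral_toSignedMeasure] at this
    simpa only [hK.symm y] using this
  -- `A` is the potential of `f μ` for the original kernel
  set A : Ω → ℝ := fun y => ∫ x, K x y * f x ∂μ with hA
  have hLf : Continuous fun p : Ω × Ω => K p.1 p.2 * f p.1 :=
    hK.continuous.mul (hf.comp continuous_fst)
  have hAc : Continuous A := continuous_integral hLf μ
  have hAf : Integrable (fun y => A y * f y) μ := integrable_measure_of_continuous (hAc.mul hf) μ
  have hAm : ∫ y, A y ∂μ = e * m := by
    rw [hA, integral_swap hLf]
    have : ∀ x, ∫ y, K x y * f x ∂μ = e * f x := fun x => by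
      rw [integral_mul_const]
      simp only [fun y => hK.symm x y, hKi x]
    simp only [this, integral_const_mul, hm]
  have hgoal : ∫ y, (∫ x, (K x y - e) * f x ∂μ) * f y ∂μ = (∫ y, A y * f y ∂μ) - e * m ^ 2 := by
    have : ∀ y, ∫ x, (K x y - e) * f x ∂μ = A y - e * m := fun y => by
      simp only [sub_mul]
      rw [integral_sub (hKf y) (hfi.const_mul e), integral_const_mul]
    simp only [this, fun y => sub_mul (A y) (e * m) (f y)]
    rw [integral_sub hAf (hfi.const_mul _),
      integral_const_mul]
    ring
  rw [hgoal]
  obtain ⟨C, hC⟩ := isCompact_univ.exists_bound_of_continuousOn hf.continuousOn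
  set ε : ℝ := 1 / (|C| + |m| + 1) with hε
  have hD : 0 < |C| + |m| + 1 := by positivity
  have hε0 : 0 < ε := by positivity
  set g : Ω → ℝ := fun x => (1 - ε * m) + ε * f x with hg
  have hgc : Continuous g := by fun_prop
  have hg0 : ∀ x, 0 ≤ g x := fun x => by
    have h1 : |f x| ≤ |C| := (hC x trivial).trans (le_abs_self C)
    have h2 : ε * (|C| + |m|) ≤ 1 := by
      rw [hε, div_mul_eq_mul_div, div_le_one hD]; linarith
    have h3 : ε * (m - f x) ≤ ε * (|C| + |m|) :=
      mul_le_mul_of_nonneg_left (by linarith [le_abs_self m, neg_abs_le (f x)]) hε0.le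
    simp only [hg]
    linarith
  have hgm : ∫ x, g x ∂μ = 1 := by
    simp only [hg]
    rw [integral_add (integrable_const _) (hfi.const_mul ε), integral_const_mul]
    simp
    ring
  set ρ := μ.withDensity fun x => ENNReal.ofReal (g x) with hρ
  have hρint : ∀ u : Ω → ℝ, ∫ x, u x ∂ρ = ∫ x, g x * u x ∂μ := fun u => by
    rw [hρ, integral_withDensity_eq_integral_toReal_smul (by fun_prop) (by simp)]
    simp only [ENNReal.toReal_ofReal (hg0 _), smul_eq_mul]
  have hρ1 : IsProbabilityMeasure ρ := by
    refine ⟨?_⟩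
    rw [hρ, withDensity_apply _ MeasurableSet.univ, Measure.restrict_univ,
      ← ofReal_integral_eq_lintegral_ofReal (integrable_measure_of_continuous hgc μ)
        (Eventually.of_forall hg0), hgm, ENNReal.ofReal_one]
  have hmin := isMinOn_iff.1 h _ (toSignedMeasure_mem_probMeasures ρ)
  have hEρ : energy K ρ.toSignedMeasure = ∫ y, g y * ∫ x, g x * K x y ∂μ ∂μ := by
    unfold energy mixedEnergy
    simp only [VectorMeasure.integral_toSignedMeasure, hρint]
  have hin : ∀ y, ∫ x, g x * K x y ∂μ = (1 - ε * m) * e + ε * A y := fun y => by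
    have : ∀ x, g x * K x y = (1 - ε * m) * K x y + ε * (K x y * f x) := fun x => by
      simp only [hg]; ring
    simp only [this]
    rw [integral_add ((integrable_measure_of_continuous (continuous_left hK.continuous y) μ).const_mul _)
      ((hKf y).const_mul _), integral_const_mul, integral_const_mul, hKi]
  have hout : energy K ρ.toSignedMeasure = e + ε ^ 2 * ((∫ y, A y * f y ∂μ) - e * m ^ 2) := by
    rw [hEρ]
    simp only [hin]
    have : ∀ y, g y * ((1 - ε * m) * e + ε * A y)
        = (1 - ε * m) * e * g y + (ε * (1 - ε * m) * A y + ε ^ 2 * (A y * f y)) := fun y => by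
      simp only [hg]; ring
    simp only [this]
    have hA1 : Integrable (fun y => ε * (1 - ε * m) * A y) μ :=
      (integrable_measure_of_continuous hAc μ).const_mul _
    have hA2 : Integrable (fun y => ε ^ 2 * (A y * f y)) μ := hAf.const_mul _
    have hA12 : Integrable (fun y => ε * (1 - ε * m) * A y + ε ^ 2 * (A y * f y)) μ := hA1.add hA2
    rw [integral_add ((integrable_measure_of_continuous hgc μ).const_mul _) hA12,
      integral_add hA1 hA2,
      integral_const_mul, integral_const_mul, integral_const_mul, hgm, hAm]
    ring
  rw [hout] at hmin
  exact (mul_nonneg_iff_of_pos_left (by positivity : 0 < ε ^ 2)).1 (by linarith)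

end Density
/-! ### Eigenbases of compact symmetric operators -/

section Spectral

open Module.End in
/-- The spectral theorem for a compact symmetric operator, in the form of an orthonormal basis of
eigenvectors that contains a prescribed unit eigenvector. -/
theorem exists_hilbertBasis_eigenvectors {E : Type*} [NormedAddCommGroup E] [InnerProductSpace ℝ E]
    [CompleteSpace E] {T : E →L[ℝ] E} (hT : IsCompactOperator T) (hT' : T.IsSymmetric) {e : E}
    (he : ‖e‖ = 1) {c₀ : ℝ} (hTe : T e = c₀ • e) :
    ∃ (w : Set E) (b : HilbertBasis w ℝ E), e ∈ w ∧ ⇑b = ((↑) : w → E) ∧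
      ∀ v ∈ w, ∃ c : ℝ, T v = c • v := by
  classical
  -- the basis is the union over `c` of orthonormal bases of the eigenspaces
  have hV : ∀ c : ℝ, ∃ s : Set E, Orthonormal ℝ ((↑) : s → E) ∧
      (∀ v ∈ s, T v = c • v) ∧ (T e = c • e → e ∈ s) ∧
      ∀ x : E, (∀ v ∈ s, inner ℝ x v = 0) → ∀ v, T v = c • v → inner ℝ x v = 0 := by
    intro c
    let V := eigenspace (T : Module.End ℝ E) c
    have hmem : ∀ v, v ∈ V ↔ T v = c • v := fun v => mem_eigenspace_iff
    have : CompleteSpace V := by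
      have : IsClosed (V : Set E) := by
        have : (V : Set E) = {v | T v = c • v} := by ext v; exact hmem v
        rw [this]
        exact isClosed_eq T.continuous (continuous_const_smul c)
      exact this.completeSpace_coe
    have hs0 : Orthonormal ℝ ((↑) : {v : V | (v : E) = e} → V) := by
      refine ⟨fun v => ?_, fun v w hvw => ?_⟩
      · have : ((v : V) : E) = e := v.2
        rw [Submodule.coe_norm, this, he]
      · exact (hvw (Subtype.ext (Subtype.ext (v.2.trans w.2.symm)))).elim
    obtain ⟨u, b, hsu, hb⟩ := hs0.exists_hilbertBasis_extension
    refine ⟨(↑) '' u, ?_, ?_, fun h => ?_, fun x hx v hv => ?_⟩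
    · have h1 : Orthonormal ℝ ((↑) : u → V) := hb ▸ b.orthonormal
      refine ⟨?_, ?_⟩
      · rintro ⟨-, v, hv, rfl⟩
        exact h1.1 ⟨v, hv⟩
      · rintro ⟨-, v, hv, rfl⟩ ⟨-, w, hw, rfl⟩ hvw
        exact h1.2 (i := ⟨v, hv⟩) (j := ⟨w, hw⟩)
          fun h => hvw (Subtype.ext (congrArg (fun z : u => ((z : V) : E)) h))
    · rintro - ⟨v, -, rfl⟩
      exact (hmem _).1 v.2
    · exact ⟨⟨e, (hmem e).2 h⟩, hsu rfl, rfl⟩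
    · have h1 := (b.hasSum_repr ⟨v, (hmem v).2 hv⟩).mapL ((innerSL ℝ x).comp V.subtypeL)
      have h2 : ∀ i, ((innerSL ℝ x).comp V.subtypeL)
          ((b.repr ⟨v, (hmem v).2 hv⟩) i • b i) = 0 := fun i => by
        rw [map_smul, hb]
        have := hx i ⟨i, i.2, rfl⟩
        simp [this]
      simp only [h2] at h1
      simpa using h1.unique hasSum_zero
  choose s hs1 hs2 hs3 hs4 using hV
  have hw : Orthonormal ℝ ((↑) : (⋃ c, s c) → E) := by
    refine ⟨?_, ?_⟩
    · rintro ⟨v, hv⟩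
      obtain ⟨c, hc⟩ := Set.mem_iUnion.1 hv
      exact (hs1 c).1 ⟨v, hc⟩
    · rintro ⟨v, hv⟩ ⟨w, hw⟩ hvw
      obtain ⟨c, hc⟩ := Set.mem_iUnion.1 hv
      obtain ⟨d, hd⟩ := Set.mem_iUnion.1 hw
      rcases eq_or_ne c d with rfl | hcd
      · exact (hs1 c).2 (i := ⟨v, hc⟩) (j := ⟨w, hd⟩) fun h => hvw (by simpa using h)
      · have h1 : inner ℝ (T v) w = inner ℝ v (T w) := hT' v w
        rw [hs2 c v hc, hs2 d w hd, inner_smul_left, inner_smul_right] at h1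
        have h2 : (c - d) * inner ℝ v w = 0 := by
          rw [sub_mul]; exact sub_eq_zero.2 h1
        exact (mul_eq_zero.1 h2).resolve_left (sub_ne_zero.2 hcd)
  have hbot : (Submodule.span ℝ (Set.range ((↑) : (⋃ c, s c) → E)))ᗮ = ⊥ := by
    rw [eq_bot_iff, ← ContinuousLinearMap.orthogonalComplement_iSup_eigenspaces_eq_bot hT hT',
      ← Submodule.iInf_orthogonal]
    intro x hx
    refine Submodule.mem_iInf _ |>.2 fun c => (Submodule.mem_orthogonal' _ _).2 fun v hv => ?_
    refine hs4 c x (fun u hu => ?_) v (mem_eigenspace_iff.1 hv)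
    exact (Submodule.mem_orthogonal' _ _).1 hx u
      (Submodule.subset_span ⟨⟨u, Set.mem_iUnion.2 ⟨c, hu⟩⟩, rfl⟩)
  refine ⟨⋃ c, s c, HilbertBasis.mkOfOrthogonalEqBot hw hbot, Set.mem_iUnion.2 ⟨c₀, hs3 c₀ hTe⟩,
    HilbertBasis.coe_mkOfOrthogonalEqBot _ _, fun v hv => ?_⟩
  obtain ⟨c, hc⟩ := Set.mem_iUnion.1 hv
  exact ⟨c, hs2 c v hc⟩

/-- A Hilbert basis has as many elements as the algebraic dimension once all infinite cardinals are
identified. -/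
lemma toENat_rank_eq_encard {E : Type*} [NormedAddCommGroup E] [InnerProductSpace ℝ E]
    {w : Set E} (b : HilbertBasis w ℝ E) :
    Cardinal.toENat (Module.rank ℝ E) = w.encard := by
  rcases w.finite_or_infinite with hw | hw
  · have := hw.fintype
    have h1 := rank_eq_card_basis b.toOrthonormalBasis.toBasis
    rw [h1, Set.encard_eq_coe_toFinset_card, Set.toFinset_card]
    simp
  · have := hw.to_subtype
    rw [hw.encard_eq, Cardinal.toENat_eq_top]
    have h2 := b.orthonormal.linearIndependent.cardinal_le_rank
    exact (Cardinal.aleph0_le_mk _).trans h2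

lemma countable_of_orthonormal {E : Type*} [NormedAddCommGroup E] [InnerProductSpace ℝ E]
    [SecondCountableTopology E] {w : Set E} (hw : Orthonormal ℝ ((↑) : w → E)) : w.Countable := by
  refine Set.PairwiseDisjoint.countable_of_isOpen (s := fun v => Metric.ball v (1 / 2)) ?_
    (fun _ _ => Metric.isOpen_ball) fun v _ => ⟨v, by simp⟩
  intro u hu v hv huv
  refine Metric.ball_disjoint_ball ?_
  have h0 : inner ℝ u v = 0 := hw.2 (i := ⟨u, hu⟩) (j := ⟨v, hv⟩) fun h => huv (by simpa using h)
  have hu1 : ‖u‖ = 1 := hw.1 ⟨u, hu⟩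
  have hv1 : ‖v‖ = 1 := hw.1 ⟨v, hv⟩
  have h := norm_sub_sq_real u v
  rw [h0, hu1, hv1] at h
  rw [dist_eq_norm]
  nlinarith [norm_nonneg (u - v)]

/-- A countable set with a marked element is enumerated from `1` on, the marked element first. -/
lemma exists_equiv_of_countable {α : Type*} {w : Set α} (hw : w.Countable) {e : α} (he : e ∈ w) :
    ∃ σ : {j : ℕ | 1 ≤ j ∧ (j : ℕ∞) ≤ w.encard} ≃ w,
      ∃ h : 1 ∈ {j : ℕ | 1 ≤ j ∧ (j : ℕ∞) ≤ w.encard}, σ ⟨1, h⟩ = ⟨e, he⟩ := by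
  classical
  have h1 : 1 ∈ {j : ℕ | 1 ≤ j ∧ (j : ℕ∞) ≤ w.encard} := by
    refine ⟨le_rfl, ?_⟩
    rw [Nat.cast_one, Set.one_le_encard_iff_nonempty]
    exact ⟨e, he⟩
  have hσ : Nonempty ({j : ℕ | 1 ≤ j ∧ (j : ℕ∞) ≤ w.encard} ≃ w) := by
    rcases w.finite_or_infinite with hf | hi
    · have hset : {j : ℕ | 1 ≤ j ∧ (j : ℕ∞) ≤ w.encard} = Set.Icc 1 w.ncard := by
        ext j
        simp [← hf.cast_ncard_eq]
      have := hf.to_subtype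
      rw [hset]
      refine Finite.card_eq.1 ?_
      rw [Nat.card_coe_set_eq, Nat.card_coe_set_eq]
      simp
    · have := hi.to_subtype
      have := hw.to_subtype
      have hset : {j : ℕ | 1 ≤ j ∧ (j : ℕ∞) ≤ w.encard} = Set.Ici 1 := by
        ext j
        simp [hi.encard_eq]
      rw [hset]
      have : Infinite (Set.Ici 1 : Set ℕ) := (Set.Ici_infinite 1).to_subtype
      exact nonempty_equiv_of_countable
  obtain ⟨σ⟩ := hσ
  exact ⟨σ.trans (Equiv.swap (σ ⟨1, h1⟩) ⟨e, he⟩), h1, by simp⟩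

/-- A compact symmetric operator on `L²(Ω, μ)` has an orthonormal basis of eigenvectors indexed by
`indexSet μ`, starting with a prescribed unit eigenvector. -/
theorem exists_hilbertBasis_indexSet {Ω : Type*} [MeasurableSpace Ω] {μ : Measure Ω}
    [SecondCountableTopology (Lp ℝ 2 μ)] {T : Lp ℝ 2 μ →L[ℝ] Lp ℝ 2 μ}
    (hT : IsCompactOperator T) (hT' : T.IsSymmetric) {e : Lp ℝ 2 μ} (he : ‖e‖ = 1) {c₀ : ℝ}
    (hTe : T e = c₀ • e) :
    ∃ (b : HilbertBasis (indexSet μ) ℝ (Lp ℝ 2 μ)) (lam : indexSet μ → ℝ),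
      (∀ j, T (b j) = lam j • b j) ∧ ∃ h : 1 ∈ indexSet μ, b ⟨1, h⟩ = e := by
  obtain ⟨w, b, hew, hb, hw⟩ := exists_hilbertBasis_eigenvectors hT hT' he hTe
  have hcount : w.Countable := by
    exact countable_of_orthonormal (hb ▸ b.orthonormal)
  have hset : indexSet μ = {j : ℕ | 1 ≤ j ∧ (j : ℕ∞) ≤ w.encard} := by
    unfold indexSet dimL2
    rw [toENat_rank_eq_encard b]
  rw [hset]
  obtain ⟨σ, h1, hσ⟩ := exists_equiv_of_countable hcount hew
  have hon : Orthonormal ℝ (b ∘ σ) := b.orthonormal.comp _ σ.injective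
  have hsp : ⊤ ≤ (Submodule.span ℝ (Set.range (b ∘ σ))).topologicalClosure := by
    rw [σ.surjective.range_comp, b.dense_span]
  choose lam hlam using fun j => hw (σ j) (σ j).2
  refine ⟨HilbertBasis.mk hon hsp, lam, fun j => ?_, h1, ?_⟩
  · simp only [HilbertBasis.coe_mk, Function.comp_apply, hb]
    exact hlam j
  · simp [hb, hσ]

end Spectral

/-! ### The integral operator of a continuous kernel -/

section InnerMap

/-- The operator `v ↦ ⟪k ·, v⟫` from a Hilbert space to `C(X, ℝ)` defined by a continuous family of
vectors `k`. -/
noncomputable def innerMap {X H : Type*} [TopologicalSpace X] [CompactSpace X]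
    [NormedAddCommGroup H] [InnerProductSpace ℝ H] (k : C(X, H)) : H →L[ℝ] C(X, ℝ) :=
  LinearMap.mkContinuous
    { toFun := fun v => ⟨fun x => inner ℝ (k x) v, by fun_prop⟩
      map_add' := fun v w => by ext x; simp [inner_add_right]
      map_smul' := fun c v => by ext x; simp [inner_smul_right] }
    ‖k‖ fun v => by
      refine (ContinuousMap.norm_le _ (by positivity)).2 fun x => ?_
      exact (norm_inner_le_norm _ _).trans (by gcongr; exact k.norm_coe_le_norm x)

/-- By the Arzelà–Ascoli theorem, since `|⟪k x, v⟫ - ⟪k y, v⟫| ≤ ‖k x - k y‖` on the unit ball. -/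
lemma isCompactOperator_innerMap {X H : Type*} [TopologicalSpace X] [CompactSpace X]
    [NormedAddCommGroup H] [InnerProductSpace ℝ H] (k : C(X, H)) :
    IsCompactOperator (innerMap k) := by
  let I := ContinuousMap.isometryEquivBoundedOfCompact X ℝ
  have hc : IsCompact (closure (I '' (innerMap k '' Metric.closedBall 0 1))) := by
    refine BoundedContinuousFunction.arzela_ascoli (Metric.closedBall 0 ‖k‖)
      (isCompact_closedBall _ _) _ ?_ ?_
    · rintro - x ⟨-, ⟨v, hv, rfl⟩, rfl⟩
      change inner ℝ (k x) v ∈ _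
      rw [mem_closedBall_zero_iff] at hv ⊢
      refine (norm_inner_le_norm _ _).trans ?_
      calc ‖k x‖ * ‖v‖ ≤ ‖k‖ * 1 := by gcongr; exact k.norm_coe_le_norm x
        _ = ‖k‖ := mul_one _
    · refine fun x => Metric.equicontinuousAt_iff_right.2 fun ε hε => ?_
      filter_upwards [Metric.tendsto_nhds.1 (k.continuous.tendsto x) ε hε] with y hy
      rintro ⟨-, -, ⟨v, hv, rfl⟩, rfl⟩
      change dist (inner ℝ (k x) v) (inner ℝ (k y) v) < ε
      rw [mem_closedBall_zero_iff] at hv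
      rw [dist_eq_norm, ← inner_sub_left]
      rw [dist_comm, dist_eq_norm] at hy
      refine (norm_inner_le_norm _ _).trans_lt ?_
      calc ‖k x - k y‖ * ‖v‖ ≤ ‖k x - k y‖ * 1 := by gcongr
        _ < ε := by rwa [mul_one]
  have hc' := (isCompactOperator_iff_image_closedBall_subset_compact
    (innerMap k : H →ₗ[ℝ] C(X, ℝ)) one_pos).2
    ⟨_, hc.image I.symm.continuous, fun f hf => ⟨I f, subset_closure ⟨f, hf, rfl⟩, by simp⟩⟩
  exact hc'

end InnerMap

section Operator

variable {Ω : Type*} [MetricSpace Ω] [CompactSpace Ω] [MeasurableSpace Ω] [BorelSpace Ω]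
  (μ : Measure Ω) [IsFiniteMeasure μ] (L : C(Ω × Ω, ℝ))

/-- The sections `L(x, ·)` of a continuous kernel, as a continuous family in `L²(μ)`. -/
noncomputable def kernelSection : C(Ω, Lp ℝ 2 μ) :=
  ⟨fun x => ContinuousMap.toLp 2 μ ℝ (L.curry x), by fun_prop⟩

/-- The integral operator with kernel `L`, with values in the continuous functions. -/
noncomputable def integralOpC : Lp ℝ 2 μ →L[ℝ] C(Ω, ℝ) := innerMap (kernelSection μ L)

/-- The integral operator with kernel `L` on `L²(μ)`. -/
noncomputable def integralOp : Lp ℝ 2 μ →L[ℝ] Lp ℝ 2 μ :=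
  (ContinuousMap.toLp 2 μ ℝ).comp (integralOpC μ L)

lemma inner_toLp (f : C(Ω, ℝ)) (g : Lp ℝ 2 μ) :
    inner ℝ (ContinuousMap.toLp 2 μ ℝ f) g = ∫ y, f y * g y ∂μ := by
  rw [L2.inner_def]
  refine integral_congr_ae ?_
  filter_upwards [ContinuousMap.coeFn_toLp (p := 2) (𝕜 := ℝ) μ f] with y hy
  rw [hy]
  simp [mul_comm]

lemma integralOpC_apply (f : Lp ℝ 2 μ) (x : Ω) :
    integralOpC μ L f x = ∫ y, L (x, y) * f y ∂μ :=
  inner_toLp μ (L.curry x) f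

lemma isCompactOperator_integralOp : IsCompactOperator (integralOp μ L) :=
  (isCompactOperator_innerMap (kernelSection μ L)).continuous_comp
    (ContinuousMap.toLp (E := ℝ) 2 μ ℝ).continuous

lemma isSymmetric_integralOp (hL : ∀ x y, L (x, y) = L (y, x)) :
    (integralOp μ L).IsSymmetric := by
  intro f g
  have hf : Integrable f μ := (Lp.memLp f).integrable one_le_two
  have hg : Integrable g μ := (Lp.memLp g).integrable one_le_two
  change inner ℝ (ContinuousMap.toLp 2 μ ℝ (integralOpC μ L f)) g
    = inner ℝ f (ContinuousMap.toLp 2 μ ℝ (integralOpC μ L g))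
  rw [real_inner_comm _ f, inner_toLp, inner_toLp]
  simp only [integralOpC_apply, ← integral_mul_const]
  rw [integral_integral_swap]
  · refine integral_congr_ae (Eventually.of_forall fun y => ?_)
    refine integral_congr_ae (Eventually.of_forall fun x => ?_)
    simp only [hL x y]
    ring
  · have h1 : Integrable (fun p : Ω × Ω => g p.1 * f p.2) (μ.prod μ) := hg.mul_prod hf
    have h2 := h1.bdd_mul (c := ‖L‖) (f := fun p => L p) L.continuous.aestronglyMeasurable
      (Eventually.of_forall fun p => L.norm_coe_le_norm p)
    refine h2.congr (Eventually.of_forall fun p => ?_)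
    simp only [Function.uncurry]
    ring

/-- A continuous kernel of nonnegative total mass on every open square `U × U` is nonnegative on
the diagonal, provided that the measure charges every nonempty open set. -/
lemma diag_nonneg_of_integral [μ.IsOpenPosMeasure] (M : C(Ω × Ω, ℝ))
    (hM : ∀ U, IsOpen U → 0 ≤ ∫ x in U, ∫ y in U, M (x, y) ∂μ ∂μ) (x : Ω) : 0 ≤ M (x, x) := by
  by_contra! hneg
  -- by continuity `M` stays below this negative constant on some `U × U`
  set c := M (x, x) / 2 with hc
  have hc0 : c < 0 := by linarith
  have hnear : ∀ᶠ p in nhds (x, x), M p < c :=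
    M.continuous.continuousAt.eventually_lt continuousAt_const (by linarith)
  rw [nhds_prod_eq, eventually_prod_self_iff'] at hnear
  obtain ⟨V, hV, hVM⟩ := hnear
  obtain ⟨U, hUV, hU, hxU⟩ := mem_nhds_iff.1 hV
  have hμU : 0 < μ.real U := by
    rw [Measure.real, ENNReal.toReal_pos_iff]
    exact ⟨hU.measure_pos μ ⟨x, hxU⟩, measure_lt_top _ _⟩
  have h1 : ∀ x ∈ U, ∫ y in U, M (x, y) ∂μ ≤ c * μ.real U := fun x hx => by
    have : ∫ y in U, M (x, y) ∂μ ≤ ∫ y in U, c ∂μ :=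
      setIntegral_mono_on (integrable_measure_of_continuous (by fun_prop) _)
        (integrable_const _) hU.measurableSet fun y hy => (hVM _ (hUV hx) _ (hUV hy)).le
    simpa [mul_comm] using this
  have h2 : ∫ x in U, ∫ y in U, M (x, y) ∂μ ∂μ ≤ ∫ x in U, c * μ.real U ∂μ := by
    refine setIntegral_mono_on (integrable_measure_of_continuous ?_ _) (integrable_const _)
      hU.measurableSet h1
    exact continuous_integral (L := fun y x => M (x, y)) (by fun_prop) _
  have h3 : ∫ x in U, c * μ.real U ∂μ = c * μ.real U ^ 2 := by
    simp
    ring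
  have h4 := hM U hU
  have h5 : c * μ.real U ^ 2 < 0 := mul_neg_of_neg_of_pos hc0 (by positivity)
  linarith

/-- The product `(x, y) ↦ u x * u y`. -/
def tensorSq (u : C(Ω, ℝ)) : C(Ω × Ω, ℝ) := u.comp ContinuousMap.fst * u.comp ContinuousMap.snd

end Operator

/-! ### Mercer's theorem -/

section Mercer

variable {Ω : Type*} [MetricSpace Ω] [CompactSpace Ω] [MeasurableSpace Ω] [BorelSpace Ω]
  {μ : Measure Ω} [IsFiniteMeasure μ] {L : C(Ω × Ω, ℝ)} {ι : Type*}
  {b : HilbertBasis ι ℝ (Lp ℝ 2 μ)} {lam : ι → ℝ}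

lemma eigenvalue_nonneg (hb : ∀ j, integralOp μ L (b j) = lam j • b j)
    (hpos : ∀ f, 0 ≤ inner ℝ (integralOp μ L f) f) (j : ι) : 0 ≤ lam j := by
  have := hpos (b j)
  rwa [hb, inner_smul_left, real_inner_self_eq_norm_sq, b.orthonormal.1 j, one_pow, mul_one]
    at this

lemma sum_eigenvalue_mul_inner_sq_le (hL : ∀ x y, L (x, y) = L (y, x))
    (hb : ∀ j, integralOp μ L (b j) = lam j • b j)
    (hpos : ∀ f, 0 ≤ inner ℝ (integralOp μ L f) f) (s : Finset ι) (f : Lp ℝ 2 μ) :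
    ∑ j ∈ s, lam j * inner ℝ f (b j) ^ 2 ≤ inner ℝ (integralOp μ L f) f := by
  have h := b.hasSum_inner_mul_inner (integralOp μ L f) f
  have h1 : ∀ j, inner ℝ (integralOp μ L f) (b j) * inner ℝ (b j) f
      = lam j * inner ℝ f (b j) ^ 2 := fun j => by
    have : inner ℝ (integralOp μ L f) (b j) = inner ℝ f (integralOp μ L (b j)) :=
      isSymmetric_integralOp μ L hL f (b j)
    rw [this, hb, inner_smul_right, real_inner_comm f]
    ring
  simp only [h1] at h
  exact sum_le_hasSum s (fun j _ => mul_nonneg (eigenvalue_nonneg hb hpos j) (sq_nonneg _)) h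

/-- Bessel's inequality on the diagonal. With `u j` the continuous image `lam j • b j` of `b j`,
the terms of the Mercer series are `(lam j)⁻¹ * u j x * u j y`; those with `lam j = 0` vanish. -/
lemma sum_inv_eigenvalue_mul_sq_le [μ.IsOpenPosMeasure] (hL : ∀ x y, L (x, y) = L (y, x))
    (hb : ∀ j, integralOp μ L (b j) = lam j • b j)
    (hpos : ∀ f, 0 ≤ inner ℝ (integralOp μ L f) f) (s : Finset ι) (x : Ω) :
    ∑ j ∈ s, (lam j)⁻¹ * integralOpC μ L (b j) x ^ 2 ≤ L (x, x) := by
  let M : C(Ω × Ω, ℝ) := L - ∑ j ∈ s, (lam j)⁻¹ • tensorSq (integralOpC μ L (b j))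
  have hMapp : ∀ x y, M (x, y) = L (x, y)
      - ∑ j ∈ s, (lam j)⁻¹ * integralOpC μ L (b j) x * integralOpC μ L (b j) y := fun x y => by
    simp [M, tensorSq, ContinuousMap.sum_apply, mul_assoc]
  have hM : 0 ≤ M (x, x) := by
    refine diag_nonneg_of_integral μ M (fun U hU => ?_) x
    let f : Lp ℝ 2 μ := indicatorConstLp 2 hU.measurableSet (measure_ne_top μ U) (1 : ℝ)
    have hf : ∀ g : C(Ω, ℝ), inner ℝ f (ContinuousMap.toLp 2 μ ℝ g) = ∫ y in U, g y ∂μ := by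
      intro g
      rw [L2.inner_indicatorConstLp_one]
      refine integral_congr_ae (ae_restrict_of_ae ?_)
      exact ContinuousMap.coeFn_toLp (p := 2) (𝕜 := ℝ) μ g
    have hLf : ∀ x, ∫ y in U, L (x, y) ∂μ = integralOpC μ L f x := fun x => by
      exact (hf (L.curry x)).symm.trans (real_inner_comm _ _)
    have hu : ∀ j, ∫ y in U, integralOpC μ L (b j) y ∂μ = lam j * inner ℝ f (b j) := fun j => by
      rw [← hf, ← inner_smul_right, ← hb]
      rfl
    have h1 : ∀ x, ∫ y in U, M (x, y) ∂μ = integralOpC μ L f x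
        - ∑ j ∈ s, (lam j)⁻¹ * integralOpC μ L (b j) x * (lam j * inner ℝ f (b j)) := fun x => by
      simp only [hMapp]
      rw [integral_sub, integral_finsetSum, hLf]
      · simp only [integral_const_mul, hu]
      · exact fun j _ => integrable_measure_of_continuous (by fun_prop) _
      · exact integrable_measure_of_continuous (by fun_prop) _
      · exact integrable_measure_of_continuous (by fun_prop) _
    simp only [h1]
    rw [integral_sub, integral_finsetSum]
    · simp only [integral_mul_const, integral_const_mul, hu]
      have h2 := sum_eigenvalue_mul_inner_sq_le hL hb hpos s f
      rw [real_inner_comm] at h2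
      have h3 : inner ℝ f (integralOp μ L f) = ∫ x in U, integralOpC μ L f x ∂μ := hf _
      rw [h3] at h2
      refine sub_nonneg.2 (le_trans (Finset.sum_le_sum fun j _ => ?_) h2)
      rcases eq_or_ne (lam j) 0 with h0 | h0
      · simp [h0]
      · refine le_of_eq ?_
        field_simp
    · exact fun j _ => integrable_measure_of_continuous (by fun_prop) _
    · exact integrable_measure_of_continuous (by fun_prop) _
    · exact integrable_measure_of_continuous (by fun_prop) _
  rw [hMapp] at hM
  simpa [pow_two, mul_assoc] using hM

lemma sq_sum_mul_le {ι : Type*} (s : Finset ι) {a : ι → ℝ} (ha : ∀ j, 0 ≤ a j) (u v : ι → ℝ) :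
    (∑ j ∈ s, a j * u j * v j) ^ 2 ≤ (∑ j ∈ s, a j * u j ^ 2) * ∑ j ∈ s, a j * v j ^ 2 :=
  Finset.sum_sq_le_sum_mul_sum_of_sq_le_mul s (fun j _ => mul_nonneg (ha j) (sq_nonneg _))
    (fun j _ => mul_nonneg (ha j) (sq_nonneg _)) fun j _ => le_of_eq (by ring)

/-- If `L` is symmetric and of positive type on `L²(μ)`, its eigenfunction series converges to `L`
pointwise. For fixed `x` the series of the section `L(x, ·)` converges uniformly, and its sum
is `L(x, ·)` because the same series is the expansion of `L(x, ·)` in the basis `b`. -/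
lemma hasSum_mercer_apply [μ.IsOpenPosMeasure] (hL : ∀ x y, L (x, y) = L (y, x))
    (hb : ∀ j, integralOp μ L (b j) = lam j • b j)
    (hpos : ∀ f, 0 ≤ inner ℝ (integralOp μ L f) f) (x y : Ω) :
    HasSum (fun j => (lam j)⁻¹ * integralOpC μ L (b j) x * integralOpC μ L (b j) y) (L (x, y)) := by
  set u : ι → C(Ω, ℝ) := fun j => integralOpC μ L (b j) with hu
  have ha : ∀ j, 0 ≤ (lam j)⁻¹ := fun j => inv_nonneg.2 (eigenvalue_nonneg hb hpos j)
  have hbes : ∀ s : Finset ι, ∀ x, ∑ j ∈ s, (lam j)⁻¹ * u j x ^ 2 ≤ L (x, x) :=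
    sum_inv_eigenvalue_mul_sq_le hL hb hpos
  have hsum : Summable fun j => (lam j)⁻¹ * u j x ^ 2 :=
    summable_of_sum_le (fun j => mul_nonneg (ha j) (sq_nonneg _)) fun s => hbes s x
  have hC : Summable fun j => ((lam j)⁻¹ * u j x) • u j := by
    refine summable_iff_vanishing_norm.2 fun ε hε => ?_
    have hN : 0 < ‖L‖ + 1 := by positivity
    obtain ⟨s, hs⟩ := summable_iff_vanishing_norm.1 hsum (ε ^ 2 / (‖L‖ + 1)) (by positivity)
    refine ⟨s, fun t ht => (ContinuousMap.norm_lt_iff _ hε).2 fun y => ?_⟩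
    have h1 := hs t ht
    have h2 := hbes t y
    have h3 : L (y, y) ≤ ‖L‖ := (le_abs_self _).trans (L.norm_coe_le_norm _)
    have h4 := sq_sum_mul_le t ha (fun j => u j x) (fun j => u j y)
    have h5 : 0 ≤ ∑ j ∈ t, (lam j)⁻¹ * u j y ^ 2 :=
      Finset.sum_nonneg fun j _ => mul_nonneg (ha j) (sq_nonneg _)
    have h6 : ∑ j ∈ t, (lam j)⁻¹ * u j x ^ 2 < ε ^ 2 / (‖L‖ + 1) := (le_abs_self _).trans_lt h1
    have h7 : (∑ j ∈ t, (lam j)⁻¹ * u j x * u j y) ^ 2 < ε ^ 2 := by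
      refine h4.trans_lt ?_
      calc _ ≤ ε ^ 2 / (‖L‖ + 1) * ‖L‖ := mul_le_mul h6.le (h2.trans h3) h5 (by positivity)
        _ < ε ^ 2 / (‖L‖ + 1) * (‖L‖ + 1) := by gcongr; linarith
        _ = ε ^ 2 := by field_simp
    simpa [ContinuousMap.sum_apply] using abs_lt_of_sq_lt_sq h7 hε.le
  have hval : ∑' j, ((lam j)⁻¹ * u j x) • u j = L.curry x := by
    refine ContinuousMap.toLp_injective (p := 2) (𝕜 := ℝ) μ ?_
    have h1 := hC.hasSum.mapL (ContinuousMap.toLp (E := ℝ) 2 μ ℝ)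
    have h2 := b.hasSum_repr (kernelSection μ L x)
    refine h1.unique (h2.congr_fun fun j => ?_)
    have h3 : ContinuousMap.toLp (E := ℝ) 2 μ ℝ (u j) = lam j • b j := hb j
    have h4 : inner ℝ (b j) (kernelSection μ L x) = u j x := real_inner_comm _ _
    rw [map_smul, h3, b.repr_apply_apply, h4, smul_smul]
    rcases eq_or_ne (lam j) 0 with h0 | h0
    · have h5 : u j = 0 := by
        refine ContinuousMap.toLp_injective (p := 2) (𝕜 := ℝ) μ ?_
        rw [h3, h0, zero_smul, map_zero]
      simp [h5]
    · congr 1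
      field_simp
  have h8 := hC.hasSum
  rw [hval] at h8
  simpa using h8.mapL (ContinuousMap.evalCLM ℝ y)

/-- **Mercer's theorem.** The eigenfunction series of a symmetric continuous kernel of positive type
converges uniformly: on the diagonal by Dini's theorem, and then everywhere by the Cauchy–Schwarz
inequality. -/
theorem hasSum_mercer [μ.IsOpenPosMeasure] (hL : ∀ x y, L (x, y) = L (y, x))
    (hb : ∀ j, integralOp μ L (b j) = lam j • b j)
    (hpos : ∀ f, 0 ≤ inner ℝ (integralOp μ L f) f) :
    HasSum (fun j => (lam j)⁻¹ • tensorSq (integralOpC μ L (b j))) L := by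
  set u : ι → C(Ω, ℝ) := fun j => integralOpC μ L (b j) with hu
  have ha : ∀ j, 0 ≤ (lam j)⁻¹ := fun j => inv_nonneg.2 (eigenvalue_nonneg hb hpos j)
  have hdiag : Summable fun j => (lam j)⁻¹ • u j ^ 2 := by
    let D : C(Ω, ℝ) := L.comp ⟨fun x => (x, x), by fun_prop⟩
    refine ⟨D, ?_⟩
    refine ContinuousMap.tendsto_iff_tendstoUniformly.2 ?_
    refine Monotone.tendstoUniformly_of_forall_tendsto (fun s => ContinuousMap.continuous _) ?_
      D.continuous fun x => ?_
    · intro s t hst x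
      simp only [ContinuousMap.sum_apply]
      exact Finset.sum_le_sum_of_subset_of_nonneg hst fun j _ _ =>
        mul_nonneg (ha j) (sq_nonneg _)
    · have := hasSum_mercer_apply hL hb hpos x x
      refine Tendsto.congr (fun s => ?_) this
      simp [ContinuousMap.sum_apply, hu, pow_two, mul_assoc]
  have hsum : Summable fun j => (lam j)⁻¹ • tensorSq (u j) := by
    refine summable_iff_vanishing_norm.2 fun ε hε => ?_
    obtain ⟨s, hs⟩ := summable_iff_vanishing_norm.1 hdiag ε hε
    refine ⟨s, fun t ht => (ContinuousMap.norm_lt_iff _ hε).2 fun p => ?_⟩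
    have h1 : ∀ x, ∑ j ∈ t, (lam j)⁻¹ * u j x ^ 2 < ε := fun x => by
      have := (ContinuousMap.norm_lt_iff _ hε).1 (hs t ht) x
      simp only [ContinuousMap.sum_apply] at this
      exact (le_abs_self _).trans_lt this
    have h0 : 0 ≤ ∑ j ∈ t, (lam j)⁻¹ * u j p.2 ^ 2 :=
      Finset.sum_nonneg fun j _ => mul_nonneg (ha j) (sq_nonneg _)
    have h2 := sq_sum_mul_le t ha (fun j => u j p.1) (fun j => u j p.2)
    have h3 : (∑ j ∈ t, (lam j)⁻¹ * u j p.1 * u j p.2) ^ 2 < ε ^ 2 := by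
      refine h2.trans_lt ?_
      rw [pow_two]
      exact mul_lt_mul'' (h1 p.1) (h1 p.2)
        (Finset.sum_nonneg fun j _ => mul_nonneg (ha j) (sq_nonneg _)) h0
    simpa [ContinuousMap.sum_apply, tensorSq, mul_assoc] using abs_lt_of_sq_lt_sq h3 hε.le
  have hval : ∑' j, (lam j)⁻¹ • tensorSq (u j) = L := by
    ext ⟨x, y⟩
    have h1 := hsum.hasSum.mapL (ContinuousMap.evalCLM ℝ (x, y))
    refine h1.unique ((hasSum_mercer_apply hL hb hpos x y).congr_fun fun j => ?_)
    simp [tensorSq, hu, mul_assoc]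
  have h := hsum.hasSum
  rwa [hval] at h

end Mercer
/-! ### The Mercer expansion at a minimizer -/

section MercerExpansion

variable {Ω : Type*} [MetricSpace Ω] [CompactSpace Ω] [MeasurableSpace Ω] [BorelSpace Ω]
  {K : Ω → Ω → ℝ} {μ : Measure Ω} [IsProbabilityMeasure μ]

/-- The minimizing property extends by density from continuous functions to `L²(μ)`. -/
lemma nonneg_inner_integralOp_of_isMinOn (hK : IsKernel K)
    (hinv : IsInvariant K μ.toSignedMeasure)
    (h : IsMinOn (energy K) (probMeasures Ω) μ.toSignedMeasure) (L : C(Ω × Ω, ℝ))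
    (hL : ∀ x y, L (x, y) = K x y - energy K μ.toSignedMeasure) (f : Lp ℝ 2 μ) :
    0 ≤ inner ℝ (integralOp μ L f) f := by
  have hdense := ContinuousMap.toLp_denseRange (p := 2) ℝ μ ℝ (by simp)
  refine hdense.induction_on (p := fun f => 0 ≤ inner ℝ (integralOp μ L f) f) f ?_ fun g => ?_
  · exact isClosed_le continuous_const (by fun_prop)
  · have h1 := nonneg_integral_of_isMinOn hK hinv h g.continuous
    have hg := ContinuousMap.coeFn_toLp (p := 2) (𝕜 := ℝ) μ g
    refine h1.trans_eq ?_
    change _ = inner ℝ (ContinuousMap.toLp 2 μ ℝ (integralOpC μ L _)) _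
    rw [inner_toLp]
    refine integral_congr_ae ?_
    filter_upwards [hg] with y hy
    rw [hy, integralOpC_apply]
    congr 1
    refine integral_congr_ae ?_
    filter_upwards [hg] with x hx
    rw [hx, hL, hK.symm x y]

/-- Mercer's theorem for `K - I_K(μ)`, a kernel of positive type that annihilates the constants, in
a basis starting with the constant function `1`. Adding `I_K(μ)` to the first eigenvalue gives the
expansion of `K`. -/
theorem hasMercerExpansion_of_isMinOn (hK : IsKernel K)
    (hinv : IsInvariant K μ.toSignedMeasure) (hsupp : μ.support = Set.univ)
    (h : IsMinOn (energy K) (probMeasures Ω) μ.toSignedMeasure) : HasMercerExpansion μ K := by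
  classical
  have : μ.IsOpenPosMeasure := ⟨fun U hU ⟨x, hx⟩ => by
    have hxs : x ∈ μ.support := hsupp ▸ Set.mem_univ x
    exact ((Measure.mem_support_iff_forall x).1 hxs U (hU.mem_nhds hx)).ne'⟩
  set e := energy K μ.toSignedMeasure with he
  let L : C(Ω × Ω, ℝ) := ⟨fun p => K p.1 p.2 - e, hK.continuous.sub continuous_const⟩
  have hLapp : ∀ x y, L (x, y) = K x y - e := fun _ _ => rfl
  have hLsymm : ∀ x y, L (x, y) = L (y, x) := fun x y => by rw [hLapp, hLapp, hK.symm]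
  have hpos := nonneg_inner_integralOp_of_isMinOn hK hinv h L hLapp
  have hKi : ∀ x, ∫ y, K x y ∂μ = e := fun x => by
    have := hinv x
    rwa [potential, VectorMeasure.integral_toSignedMeasure] at this
  let one : Lp ℝ 2 μ := ContinuousMap.toLp 2 μ ℝ (1 : C(Ω, ℝ))
  have hone : (one : Ω → ℝ) =ᵐ[μ] fun _ => 1 :=
    ContinuousMap.coeFn_toLp (p := 2) (𝕜 := ℝ) μ (1 : C(Ω, ℝ))
  have hnorm : ‖one‖ = 1 := by
    have h1 : inner ℝ one one = (1 : ℝ) := by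
      rw [inner_toLp, integral_congr_ae (g := fun _ => (1 : ℝ))]
      · simp
      · filter_upwards [hone] with y hy
        simp [hy]
    rw [real_inner_self_eq_norm_sq] at h1
    exact (pow_eq_one_iff_of_nonneg (norm_nonneg _) two_ne_zero).1 h1
  have hAone : integralOpC μ L one = 0 := by
    ext x
    rw [integralOpC_apply, integral_congr_ae (g := fun y => K x y - e)]
    · rw [integral_sub (integrable_measure_of_continuous (continuous_right hK.continuous x) μ)
        (integrable_const _), hKi]
      simp
    · filter_upwards [hone] with y hy
      simp [hy, hLapp]
  have hTone : integralOp μ L one = (0 : ℝ) • one := by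
    change ContinuousMap.toLp 2 μ ℝ (integralOpC μ L one) = _
    rw [hAone, map_zero, zero_smul]
  have : Fact ((2 : ENNReal) ≠ ⊤) := ⟨ENNReal.ofNat_ne_top⟩
  obtain ⟨b, lam, hb, h1mem, hb1⟩ := exists_hilbertBasis_indexSet
    (isCompactOperator_integralOp μ L) (isSymmetric_integralOp μ L hLsymm) hnorm hTone
  set i₁ : indexSet μ := ⟨1, h1mem⟩ with hi₁
  set u : indexSet μ → C(Ω, ℝ) := fun j => integralOpC μ L (b j) with hu
  have hmercer : HasSum (fun j => (lam j)⁻¹ • tensorSq (u j)) L := hasSum_mercer hLsymm hb hpos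
  have hlam : ∀ j, 0 ≤ lam j := eigenvalue_nonneg hb hpos
  have hu1 : u i₁ = 0 := by rw [hu]; simp only; rw [hb1, hAone]
  have hu0 : ∀ j, lam j = 0 → u j = 0 := fun j h0 => by
    refine ContinuousMap.toLp_injective (p := 2) (𝕜 := ℝ) μ ?_
    change integralOp μ L (b j) = _
    rw [hb, h0, zero_smul, map_zero]
  -- the everywhere defined eigenfunctions: continuous for `lam j ≠ 0`, any representative otherwise
  let ψ : indexSet μ → Ω → ℝ := fun j x =>
    if j = i₁ then 1 else if lam j = 0 then b j x else (lam j)⁻¹ * u j x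
  have hlam1 : lam i₁ = 0 := by
    have h1 := hb i₁
    rw [hb1, hTone, zero_smul] at h1
    refine (smul_eq_zero.1 h1.symm).resolve_right fun h0 => ?_
    rw [h0, norm_zero] at hnorm
    exact zero_ne_one hnorm
  have hbψ : ∀ j, (b j : Ω → ℝ) =ᵐ[μ] ψ j := by
    intro j
    by_cases hj : j = i₁
    · simp only [ψ, hj, if_true]
      rw [hb1]
      exact hone
    · by_cases h0 : lam j = 0
      · simp only [ψ, hj, h0, if_false, if_true]
        exact Eventually.of_forall fun _ => rfl
      · have h1 : b j = (lam j)⁻¹ • ContinuousMap.toLp 2 μ ℝ (u j) := by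
          change b j = (lam j)⁻¹ • integralOp μ L (b j)
          rw [hb, smul_smul, inv_mul_cancel₀ h0, one_smul]
        rw [← map_smul] at h1
        rw [h1]
        filter_upwards [ContinuousMap.coeFn_toLp (p := 2) (𝕜 := ℝ) μ ((lam j)⁻¹ • u j)] with x hx
        rw [hx]
        simp [ψ, hj, h0]
  have huψ : ∀ j x, u j x = lam j * ψ j x := by
    intro j x
    by_cases h0 : lam j = 0
    · rw [hu0 j h0, h0]; simp
    · have hj : j ≠ i₁ := fun hj => h0 (hj ▸ hlam1)
      simp only [ψ, hj, h0, if_false]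
      rw [mul_inv_cancel_left₀ h0]
  have hψint : ∀ j, Integrable (ψ j) μ := fun j =>
    ((Lp.memLp (b j)).integrable one_le_two).congr (hbψ j)
  have hψ0 : ∀ j, j ≠ i₁ → ∫ y, ψ j y ∂μ = 0 := fun j hj => by
    have h1 : inner ℝ one (b j) = (0 : ℝ) := by
      rw [← hb1]; exact b.orthonormal.2 (Ne.symm hj)
    rw [inner_toLp] at h1
    rw [← h1]
    refine integral_congr_ae ?_
    filter_upwards [hbψ j] with y hy
    simp [hy]
  let lam' : indexSet μ → ℝ := fun j => lam j + if j = i₁ then e else 0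
  have heig : ∀ j x, ∫ y, K x y * ψ j y ∂μ = lam' j * ψ j x := by
    intro j x
    have h1 : ∫ y, L (x, y) * ψ j y ∂μ = lam j * ψ j x := by
      rw [← huψ, hu]
      simp only
      rw [integralOpC_apply]
      refine integral_congr_ae ?_
      filter_upwards [hbψ j] with y hy
      rw [hy]
    by_cases hj : j = i₁
    · simp [ψ, lam', hj, hKi, hlam1]
    · have h2 : ∀ y, K x y * ψ j y = L (x, y) * ψ j y + e * ψ j y := fun y => by
        rw [hLapp]; ring
      simp only [h2]
      rw [integral_add _ ((hψint j).const_mul e), h1, integral_const_mul, hψ0 j hj]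
      · simp [lam', hj]
      · exact (hψint j).bdd_mul (c := ‖L‖) (f := fun y => L (x, y))
          (by fun_prop : Continuous fun y => L (x, y)).aestronglyMeasurable
          (Eventually.of_forall fun y => L.norm_coe_le_norm _)
  -- the expansion of `K`, as a series in `C(Ω × Ω, ℝ)`
  let Kc : C(Ω × Ω, ℝ) := ⟨fun p => K p.1 p.2, hK.continuous⟩
  let G : indexSet μ → C(Ω × Ω, ℝ) := fun j =>
    (lam j)⁻¹ • tensorSq (u j) + if j = i₁ then ContinuousMap.const _ e else 0
  have hG : HasSum G Kc := by
    have h1 := hmercer.add (hasSum_ite_eq i₁ (ContinuousMap.const (Ω × Ω) e))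
    have h2 : L + ContinuousMap.const (Ω × Ω) e = Kc := by
      ext ⟨x, y⟩
      simp [Kc, hLapp]
    rwa [h2] at h1
  have hGapp : ∀ j x y, G j (x, y) = lam' j * ψ j x * ψ j y := by
    intro j x y
    by_cases hj : j = i₁
    · subst hj
      simp [G, ψ, lam', hlam1]
    · rcases eq_or_ne (lam j) 0 with h0 | h0
      · simp [G, lam', hj, h0]
      · simp only [G, lam', hj, if_false, add_zero]
        simp only [ContinuousMap.smul_apply, tensorSq, ContinuousMap.mul_apply,
          ContinuousMap.comp_apply, ContinuousMap.fst_apply, ContinuousMap.snd_apply, huψ,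
          smul_eq_mul]
        field_simp
  refine ⟨fun j => if hj : j ∈ indexSet μ then lam' ⟨j, hj⟩ else 0,
    fun j => if hj : j ∈ indexSet μ then ψ ⟨j, hj⟩ else 0, ⟨⟨b, fun j => ?_⟩, fun j hj x => ?_⟩,
    ⟨fun x y => ?_, ?_⟩, ⟨1, fun x => ?_⟩, fun j hj hj2 => ?_⟩
  · simpa using hbψ j
  · simpa [hj] using heig ⟨j, hj⟩ x
  · have h1 := (hG.mapL (ContinuousMap.evalCLM ℝ (x, y))).summable.abs
    refine h1.congr fun j => ?_
    simp [hGapp]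
  · have h1 : Tendsto (fun n => (Finset.Icc 1 n).subtype (· ∈ indexSet μ)) atTop atTop := by
      refine tendsto_atTop_finset_of_monotone (fun m n hmn j => ?_) fun j => ⟨j, ?_⟩
      · simp only [Finset.mem_subtype, Finset.mem_Icc]
        exact fun hj => ⟨hj.1, hj.2.trans hmn⟩
      · simp only [Finset.mem_subtype, Finset.mem_Icc, le_refl, and_true]
        exact j.2.1
    have h2 := ContinuousMap.tendsto_iff_tendstoUniformly.1 (Tendsto.comp hG h1)
    refine (tendstoUniformly_congr (Eventually.of_forall fun n => funext fun p => ?_)).1 h2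
    simp only [Function.comp_apply, ContinuousMap.sum_apply]
    rw [← Finset.sum_subtype_eq_sum_filter]
    refine Finset.sum_congr rfl fun j _ => ?_
    rw [show p = (p.1, p.2) from rfl, hGapp]
    simp
  · simp [h1mem, ψ, hi₁]
  · have h1 : (⟨j, hj⟩ : indexSet μ) ≠ i₁ := fun h => by
      have : j = 1 := congrArg Subtype.val h
      lia
    simpa [hj, lam', h1] using hlam ⟨j, hj⟩

end MercerExpansion
end CPDEnergy

open CPDEnergy in
theorem theorem4p1 {Ω : Type*} [MetricSpace Ω] [CompactSpace Ω] [MeasurableSpace Ω] [BorelSpace Ω]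
    (K : Ω → Ω → ℝ) (hK : CPDEnergy.IsKernel K)
    (μ : Measure Ω) [IsProbabilityMeasure μ]
    (hinv : CPDEnergy.IsInvariant K μ.toSignedMeasure) (hsupp : μ.support = Set.univ) :
    List.TFAE [
      CPDEnergy.IsPosDefModConst K,
      CPDEnergy.IsCondPosDef K,
      CPDEnergy.IsDirLocalMin K μ.toSignedMeasure,
      IsMinOn (CPDEnergy.energy K) (CPDEnergy.probMeasures Ω) μ.toSignedMeasure,
      IsMinOn (CPDEnergy.energy K) (CPDEnergy.unitMassMeasures Ω) μ.toSignedMeasure,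
      ConvexOn ℝ (CPDEnergy.probMeasures Ω) (CPDEnergy.energy K),
      ConvexOn ℝ (CPDEnergy.unitMassMeasures Ω) (CPDEnergy.energy K),
      CPDEnergy.IsConvexAt K μ.toSignedMeasure,
      ∀ μ₁ ∈ CPDEnergy.probMeasures Ω, ∀ μ₂ ∈ CPDEnergy.probMeasures Ω,
        CPDEnergy.ArithMeanIneq K μ₁ μ₂,
      ∀ μ₁ ∈ CPDEnergy.unitMassMeasures Ω, ∀ μ₂ ∈ CPDEnergy.unitMassMeasures Ω,
        CPDEnergy.ArithMeanIneq K μ₁ μ₂,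
      ∀ μ₂ ∈ CPDEnergy.probMeasures Ω, CPDEnergy.ArithMeanIneq K μ.toSignedMeasure μ₂,
      CPDEnergy.HasMercerExpansion μ K,
      CPDEnergy.HasExpansion μ K] := by
  have hμ : μ.toSignedMeasure ∈ probMeasures Ω := toSignedMeasure_mem_probMeasures μ
  have hsub : probMeasures Ω ⊆ unitMassMeasures Ω := probMeasures_subset_unitMassMeasures
  tfae_have 1 → 2 := fun h => h.isCondPosDef hK
  tfae_have 2 → 1 := fun h => h.isPosDefModConst hK hinv hμ.2
  tfae_have 2 → 5 := fun h => h.isMinOn hK hinv hμ.2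
  tfae_have 5 → 4 := fun h => h.on_subset hsub
  tfae_have 4 → 3 := fun h => isDirLocalMin_of_isMinOn hμ h
  tfae_have 3 → 4 := fun h => h.isMinOn hK hinv
  tfae_have 2 → 7 := fun h => h.convexOn hK
  tfae_have 7 → 6 := fun h => h.subset hsub convex_probMeasures
  tfae_have 6 → 8 := fun h => isConvexAt_of_convexOn hμ h
  tfae_have 8 → 4 := fun h => h.isMinOn hK hinv
  tfae_have 2 → 10 := fun h μ₁ h₁ μ₂ h₂ =>
    (arithMeanIneq_iff hK _ _).2 (h.nonneg_energy_sub h₁ h₂)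
  tfae_have 10 → 9 := fun h μ₁ h₁ μ₂ h₂ => h μ₁ (hsub h₁) μ₂ (hsub h₂)
  tfae_have 9 → 11 := fun h => h _ hμ
  tfae_have 11 → 4 := fun h => isMinOn_of_arithMeanIneq hK hinv h
  tfae_have 4 → 12 := fun h => hasMercerExpansion_of_isMinOn hK hinv hsupp h
  tfae_have 12 → 13 := fun ⟨lam, φ, _, h⟩ => ⟨lam, φ, h⟩
  tfae_have 13 → 2 := fun h => h.isCondPosDef hK
  tfae_finish
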